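/- Let $n\ge 0$, $L\ge 1$, $d=2^n$. Consider a quantum model on $n$ qubits $$f(x,\theta)=\langle 0|U(x,\theta)^\dagger O\,U(x,\theta)|0\rangle,\qquad U(x,\theta)=W^{L+1}(\theta)\,S^L(x)W^L(\theta)\cdots S^1(x)W^1(\theta),\qquad x\in\mathbb R,$$ where $O$ is a Hermitian $d\times d$ matrix, $S^l(x)=e^{-ixH_l}$ with Hermitian $d\times d$ matrices $H_1,\dots,H_L$ with eigenvalues $\lambda^l_1,\dots,\lambda^l_d$ (listed with multiplicity), and $\theta$ is drawn from a probability space. Assume that the random unitaries $W^1,\dots,W^{L+1}$ are independent and that each is an exact 2-design, i.e. $\mathbb E_\theta\big[W^{\otimes 2}\otimes (W^{*})^{\otimes 2}\big]$ equals $\int V^{\otimes 2}\otimes (V^{*})^{\otimes 2}\,dV$ for the Haar probability measure on $U(d)$. For $J=(j_1,\dots,j_L)$ and $J'=(j'_1,\dots,j'_L)$ in $\{1,\dots,d\}^L$ put $\omega_{J,J'}=\sum_l(\lambda^l_{j_l}-\lambda^l_{j'_l})$. Let $\Omega=\{\omega_{J,J'}\}$ be the spectrum, $R(\omega)=\{(J,J'):\omega_{J,J'}=\omega\}$,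 $|\widetilde R(\omega)|=|R(\omega)|/d^{2L}$, and write $f(x,\theta)=\sum_{\omega\in\Omega}c_\omega(\theta)e^{i\omega x}$. Let $\|O\|_2^2=\mathrm{Tr}(O^\dagger O)$ and $\alpha=(d\|O\|_2^2-\mathrm{Tr}(O)^2)/d^2$. For a complex random variable $X$ let $\mathrm{Var}[X]=\mathbb E|X-\mathbb E X|^2$. Then: 1. For every fixed number of layers $L\ge1$, and more generally uniformly over all $L\le\kappa d^2$ for any fixed $\kappa$, $\mathrm{Var}_\theta[c_\omega]=O\big(\alpha|\widetilde R(\omega)|/d\big)$. Precisely: for every $\kappa$ there is a constant $C$, depending only on $\kappa$, such that for all $n$, all $L\ge 1$ with $L\le\kappa d^2$, all such models and all $\omega\in\Omega$, $$\mathrm{Var}_\theta[c_\omega(\theta)]\le C\,\alpha\,\frac{|\widetilde R(\omega)|}{d}.$$ (For a fixed $L$, take $\kappa=L$.) 2. For observables with $\|O\|_2^2=O(d)$ all coefficients concentrate exponentially in the number of qubits. Precisely: there is $b>1$ such that for every $K$ there is a constant $C$, depending only on $K$, such that for all $n$, all $L\ge1$, all such models with $\|O\|_2^2\le K d$ and all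 $\omega\in\Omega$, $$\mathrm{Var}_\theta[c_\omega(\theta)]\le \frac{C}{b^{n}}.$$ -/

import Mathlib

open MeasureTheory ProbabilityTheory
open scoped Matrix Kronecker

namespace QFM

/-- The unitary group `U(d)`. -/
abbrev U (d : ℕ) : Type := Matrix.unitaryGroup (Fin d) ℂ

/-- `U(d)` carries its Borel σ-algebra. -/
noncomputable instance instMeasurableSpaceU (d : ℕ) : MeasurableSpace (U d) := borel _

instance instBorelSpaceU (d : ℕ) : BorelSpace (U d) := ⟨rfl⟩

instance instCompactSpaceU (d : ℕ) : CompactSpace (U d) := by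
  have hc : IsClosed ((Matrix.unitaryGroup (Fin d) ℂ : Submonoid _) :
      Set (Matrix (Fin d) (Fin d) ℂ)) := by
    have : ((Matrix.unitaryGroup (Fin d) ℂ : Submonoid _) : Set (Matrix (Fin d) (Fin d) ℂ)) =
        {A | A * star A = 1} := by
      ext A
      exact Matrix.mem_unitaryGroup_iff
    rw [this]
    exact isClosed_eq (by fun_prop) continuous_const
  have hK : IsCompact (Set.pi Set.univ fun _ : Fin d => Set.pi Set.univ fun _ : Fin d =>
      Metric.closedBall (0 : ℂ) 1) :=
    isCompact_univ_pi fun _ => isCompact_univ_pi fun _ => isCompact_closedBall _ _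
  have hsub : ((Matrix.unitaryGroup (Fin d) ℂ : Submonoid _) :
      Set (Matrix (Fin d) (Fin d) ℂ)) ⊆
      (Set.pi Set.univ fun _ : Fin d => Set.pi Set.univ fun _ : Fin d =>
        Metric.closedBall (0 : ℂ) 1) := by
    intro A hA i _ j _
    simpa using entry_norm_bound_of_unitary hA i j
  exact isCompact_iff_compactSpace.mp (hK.of_isClosed_subset hc hsub)

/-- The Haar probability measure on `U(d)`. -/
noncomputable def haarU (d : ℕ) : Measure (U d) := Measure.haarMeasure ⊤

/-- `V ⊗ V ⊗ V* ⊗ V*`, where `V*` is the entrywise complex conjugate. -/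
noncomputable def tensorTwoTwo {d : ℕ} (V : U d) :
    Matrix ((Fin d × Fin d) × (Fin d × Fin d)) ((Fin d × Fin d) × (Fin d × Fin d)) ℂ :=
  ((V : Matrix (Fin d) (Fin d) ℂ) ⊗ₖ (V : Matrix (Fin d) (Fin d) ℂ)) ⊗ₖ
    ((V : Matrix (Fin d) (Fin d) ℂ).map star ⊗ₖ (V : Matrix (Fin d) (Fin d) ℂ).map star)

/-- The second moment superoperator `∫ W(θ)^{⊗2} ⊗ (W(θ)*)^{⊗2} dμ(θ)` (entrywise integral). -/
noncomputable def secondMoment {d : ℕ} {Θ : Type*} [MeasurableSpace Θ] (μ : Measure Θ)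
    (W : Θ → U d) :
    Matrix ((Fin d × Fin d) × (Fin d × Fin d)) ((Fin d × Fin d) × (Fin d × Fin d)) ℂ :=
  Matrix.of fun a b => ∫ θ, tensorTwoTwo (W θ) a b ∂μ

/-- A random unitary is an exact 2-design: the difference between the second moment of the Haar
distribution and its own second moment vanishes. -/
def IsTwoDesign {d : ℕ} {Θ : Type*} [MeasurableSpace Θ] (μ : Measure Θ) (W : Θ → U d) : Prop :=
  secondMoment (haarU d) id - secondMoment μ W = 0

/-- The variance `E |X - E X|²` of a complex random variable. -/
noncomputable def complexVariance {Θ : Type*} [MeasurableSpace Θ] (μ : Measure Θ)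
    (X : Θ → ℂ) : ℝ :=
  ∫ θ, ‖X θ - ∫ θ', X θ' ∂μ‖ ^ 2 ∂μ

/-- The product `A_{L-1} ⋯ A_1 A_0` (the factor with index `0` is applied first). -/
def orderedProd {R : Type*} [Monoid R] : (L : ℕ) → (Fin L → R) → R
  | 0, _ => 1
  | L + 1, A => A (Fin.last L) * orderedProd L fun l => A l.castSucc

/-- A quantum model on `n` qubits with `L` circuit layers, one real input and parameter space `Θ`:
a Hermitian observable, one encoding Hamiltonian per circuit layer, and `L + 1` trainable
parametrized unitaries. -/
structure QuantumModel (n L : ℕ) (Θ : Type*) where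
  /-- the observable `O` -/
  obs : Matrix (Fin (2 ^ n)) (Fin (2 ^ n)) ℂ
  obs_herm : obs.IsHermitian
  /-- the encoding Hamiltonians -/
  ham : Fin L → Matrix (Fin (2 ^ n)) (Fin (2 ^ n)) ℂ
  ham_herm : ∀ l, (ham l).IsHermitian
  /-- the trainable layers -/
  W : Fin (L + 1) → Θ → U (2 ^ n)

namespace QuantumModel

variable {n L : ℕ} {Θ : Type*}

/-- The encoding unitary `S^l(x) = exp(-i x H_l)`. -/
noncomputable def encoding (M : QuantumModel n L Θ) (l : Fin L) (x : ℝ) :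
    Matrix (Fin (2 ^ n)) (Fin (2 ^ n)) ℂ :=
  NormedSpace.exp (-(Complex.I * (x : ℂ)) • M.ham l)

/-- The circuit `W^{L+1}(θ) S^L(x) W^L(θ) ⋯ S^1(x) W^1(θ)`. -/
noncomputable def circuit (M : QuantumModel n L Θ) (x : ℝ) (θ : Θ) :
    Matrix (Fin (2 ^ n)) (Fin (2 ^ n)) ℂ :=
  (M.W (Fin.last L) θ : Matrix _ _ ℂ) *
    orderedProd L fun l => M.encoding l x * (M.W l.castSucc θ : Matrix _ _ ℂ)

/-- The model `f(x, θ) = ⟨0| U(x,θ)† O U(x,θ) |0⟩`, a real number as `O` is Hermitian. -/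
noncomputable def model (M : QuantumModel n L Θ) (x : ℝ) (θ : Θ) : ℝ :=
  (((M.circuit x θ)ᴴ * M.obs * M.circuit x θ) 0 0).re

/-- The eigenvalues `λ^l_j` of the encoding Hamiltonians, listed with multiplicity. -/
noncomputable def eig (M : QuantumModel n L Θ) (l : Fin L) (j : Fin (2 ^ n)) : ℝ :=
  (M.ham_herm l).eigenvalues j

/-- The rank one projection `|j⟩⟨j|` onto the `j`-th eigenvector of the `l`-th Hamiltonian. -/
noncomputable def eigProj (M : QuantumModel n L Θ) (l : Fin L) (j : Fin (2 ^ n)) :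
    Matrix (Fin (2 ^ n)) (Fin (2 ^ n)) ℂ :=
  Matrix.vecMulVec (fun a => (M.ham_herm l).eigenvectorBasis j a)
    (star fun a => (M.ham_herm l).eigenvectorBasis j a)

/-- The frequency `∑_l (λ^l_{j_l} - λ^l_{j'_l})` of a pair of paths `(J, J')`. -/
noncomputable def freq (M : QuantumModel n L Θ)
    (p : (Fin L → Fin (2 ^ n)) × (Fin L → Fin (2 ^ n))) : ℝ :=
  ∑ l, M.eig l (p.1 l) - ∑ l, M.eig l (p.2 l)

open Classical in
/-- The spectrum `Ω`, the set of distinct frequencies. -/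
noncomputable def spectrum (M : QuantumModel n L Θ) : Finset ℝ :=
  Finset.univ.image M.freq

open Classical in
/-- The frequency generator `R(ω)`. -/
noncomputable def generator (M : QuantumModel n L Θ) (ω : ℝ) :
    Finset ((Fin L → Fin (2 ^ n)) × (Fin L → Fin (2 ^ n))) :=
  Finset.univ.filter fun p => M.freq p = ω

/-- The normalized redundancy `|R(ω)| / d^{2L}` with `d = 2^n`. -/
noncomputable def normalizedRedundancy (M : QuantumModel n L Θ) (ω : ℝ) : ℝ :=
  ((M.generator ω).card : ℝ) / ((2 : ℝ) ^ n) ^ (2 * L)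

/-- The part of the circuit that follows the path `J`. -/
noncomputable def pathOp (M : QuantumModel n L Θ) (J : Fin L → Fin (2 ^ n)) (θ : Θ) :
    Matrix (Fin (2 ^ n)) (Fin (2 ^ n)) ℂ :=
  (M.W (Fin.last L) θ : Matrix _ _ ℂ) *
    orderedProd L fun l => M.eigProj l (J l) * (M.W l.castSucc θ : Matrix _ _ ℂ)

/-- The Fourier coefficient `c_ω(θ)`: the sum of the contributions of the pairs of paths in
`R(ω)`. -/
noncomputable def coeff (M : QuantumModel n L Θ) (ω : ℝ) (θ : Θ) : ℂ :=
  ∑ p ∈ M.generator ω, ((M.pathOp p.1 θ)ᴴ * M.obs * M.pathOp p.2 θ) 0 0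

/-- `‖O‖₂² = ∑_{k,k'} |O_{k,k'}|²`, the squared Schatten 2-norm. -/
noncomputable def obsNormSq (M : QuantumModel n L Θ) : ℝ :=
  ∑ k, ∑ k', ‖M.obs k k'‖ ^ 2

/-- `α = (d ‖O‖₂² - Tr(O)²) / d²` with `d = 2^n`; the trace of a Hermitian matrix is real. -/
noncomputable def alpha (M : QuantumModel n L Θ) : ℝ :=
  ((2 : ℝ) ^ n * M.obsNormSq - M.obs.trace.re ^ 2) / ((2 : ℝ) ^ n) ^ 2

/-- When the parameters are distributed according to `μ`, the trainable layers are independent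
random unitaries, each of them an exact 2-design. -/
structure HasTwoDesignLayers [MeasurableSpace Θ] (M : QuantumModel n L Θ)
    (μ : Measure Θ) : Prop where
  measurable : ∀ l, Measurable (M.W l)
  indep : iIndepFun M.W μ
  design : ∀ l, IsTwoDesign μ (M.W l)

lemma encoding_eq_sum (M : QuantumModel n L Θ) (l : Fin L) (x : ℝ) :
    M.encoding l x = ∑ j, Complex.exp (-(Complex.I * (x : ℂ)) * (M.eig l j : ℂ)) •
      M.eigProj l j := by
  set P : Matrix (Fin (2 ^ n)) (Fin (2 ^ n)) ℂ := (M.ham_herm l).eigenvectorUnitary.1 with hP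
  have hPP : P * Pᴴ = 1 := Matrix.mem_unitaryGroup_iff.mp (M.ham_herm l).eigenvectorUnitary.2
  have hH : M.ham l = P * Matrix.diagonal (fun j => (M.eig l j : ℂ)) * Pᴴ := by
    conv_lhs => rw [(M.ham_herm l).spectral_theorem]
    rfl
  have hu : IsUnit P := IsUnit.of_mul_eq_one _ hPP
  have hinv : P⁻¹ = Pᴴ := Matrix.inv_eq_right_inv hPP
  have : -(Complex.I * (x : ℂ)) • M.ham l =
      P * Matrix.diagonal (fun j => -(Complex.I * (x : ℂ)) * (M.eig l j : ℂ)) * P⁻¹ := by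
    rw [hH, hinv]
    have hd : Matrix.diagonal (fun j => -(Complex.I * (x : ℂ)) * (M.eig l j : ℂ)) =
        (-(Complex.I * (x : ℂ))) • Matrix.diagonal (fun j => (M.eig l j : ℂ)) := by
      rw [← Matrix.diagonal_smul]; rfl
    rw [hd]
    simp only [Matrix.mul_smul, Matrix.smul_mul]
  rw [encoding, this, Matrix.exp_conj _ _ hu, Matrix.exp_diagonal, hinv]
  ext a b
  rw [Matrix.mul_apply, Matrix.sum_apply]
  refine Finset.sum_congr rfl fun j _ => ?_
  rw [Matrix.mul_diagonal, Pi.coe_exp, Matrix.smul_apply, eigProj, Matrix.vecMulVec_apply,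
    Matrix.conjTranspose_apply, ← Complex.exp_eq_exp_ℂ, smul_eq_mul, Pi.star_apply, hP,
    Matrix.IsHermitian.eigenvectorUnitary_apply, Matrix.IsHermitian.eigenvectorUnitary_apply]
  ring

lemma orderedProd_sum {ι m : Type*} [Fintype ι] [DecidableEq ι] [Fintype m] [DecidableEq m] :
    ∀ (L : ℕ) (a : Fin L → ι → ℂ) (A : Fin L → ι → Matrix m m ℂ),
      orderedProd L (fun l => ∑ j, a l j • A l j) =
        ∑ J : Fin L → ι, (∏ l, a l (J l)) • orderedProd L fun l => A l (J l)
  | 0, a, A => by simp [orderedProd]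
  | L + 1, a, A => by
    rw [orderedProd, orderedProd_sum L (fun l => a l.castSucc) (fun l => A l.castSucc),
      ← (Fin.snocEquiv fun _ : Fin (L + 1) => ι).sum_comp, Fintype.sum_prod_type, Finset.sum_mul]
    refine Finset.sum_congr rfl fun j _ => ?_
    rw [Finset.mul_sum]
    refine Finset.sum_congr rfl fun J _ => ?_
    simp [Fin.prod_univ_castSucc, orderedProd, Fin.snocEquiv, smul_smul, mul_comm]

lemma circuit_eq_sum (M : QuantumModel n L Θ) (x : ℝ) (θ : Θ) :
    M.circuit x θ = ∑ J : Fin L → Fin (2 ^ n),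
      Complex.exp (-(Complex.I * (x : ℂ)) * ((∑ l, M.eig l (J l) : ℝ) : ℂ)) • M.pathOp J θ := by
  simp only [circuit, pathOp, encoding_eq_sum, Finset.sum_mul, Matrix.smul_mul]
  rw [orderedProd_sum, Finset.mul_sum]
  refine Finset.sum_congr rfl fun J _ => ?_
  rw [← Complex.exp_sum, Matrix.mul_smul, ← Finset.mul_sum]
  push_cast
  rfl

/-- The Fourier decomposition `f(x, θ) = ∑_{ω ∈ Ω} c_ω(θ) e^{iωx}`. -/
theorem model_eq_fourier_sum (M : QuantumModel n L Θ) (x : ℝ) (θ : Θ) :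
    (M.model x θ : ℂ) = ∑ ω ∈ M.spectrum, M.coeff ω θ *
      Complex.exp (Complex.I * (ω : ℂ) * (x : ℂ)) := by
  classical
  have hre : (M.model x θ : ℂ) = ((M.circuit x θ)ᴴ * M.obs * M.circuit x θ) 0 0 := by
    have hh := Matrix.isHermitian_conjTranspose_mul_mul (M.circuit x θ) M.obs_herm
    exact Complex.conj_eq_iff_re.mp (hh.apply 0 0)
  have hsum : ((M.circuit x θ)ᴴ * M.obs * M.circuit x θ) 0 0 =
      ∑ p : (Fin L → Fin (2 ^ n)) × (Fin L → Fin (2 ^ n)),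
        ((M.pathOp p.1 θ)ᴴ * M.obs * M.pathOp p.2 θ) 0 0 *
          Complex.exp (Complex.I * (M.freq p : ℂ) * (x : ℂ)) := by
    rw [circuit_eq_sum, Matrix.conjTranspose_sum, Finset.sum_mul, Finset.sum_mul,
      Matrix.sum_apply, Fintype.sum_prod_type]
    refine Finset.sum_congr rfl fun J _ => ?_
    rw [Finset.mul_sum, Matrix.sum_apply]
    refine Finset.sum_congr rfl fun J' _ => ?_
    rw [Matrix.conjTranspose_smul, Matrix.smul_mul, Matrix.smul_mul, Matrix.mul_smul,
      Matrix.smul_apply, Matrix.smul_apply, smul_eq_mul, smul_eq_mul, ← mul_assoc, mul_comm]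
    congr 1
    rw [Complex.star_def, ← Complex.exp_conj, ← Complex.exp_add]
    congr 1
    simp only [freq, map_mul, map_neg, Complex.conj_I, Complex.conj_ofReal]
    push_cast
    ring
  rw [hre, hsum, ← Finset.sum_fiberwise_of_maps_to (s := Finset.univ) (t := M.spectrum)
    (g := M.freq) (fun p _ => Finset.mem_image_of_mem _ (Finset.mem_univ p))]
  refine Finset.sum_congr rfl fun ω _ => ?_
  rw [coeff, Finset.sum_mul]
  refine Finset.sum_congr (by simp [generator]) fun p hp => ?_
  rw [generator, Finset.mem_filter] at hp
  rw [hp.2]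

end QuantumModel

end QFM

/-! Write `O` for the observable, `d` for the dimension and `O₀` for the traceless part of `O`. By
cyclicity of the trace `c_ω = tr(W† O W · D_ω)`, where `W` is the last trainable layer and `D_ω`
(`freqOp`) collects the contributions to `|0⟩⟨0|` sent through the earlier layers along pairs of
paths of frequency `ω`. The trace of `D_ω` is deterministic, 1 for `ω = 0` and 0 otherwise
(`trace_freqOp`). Hence replacing `O` by `O₀` only shifts `c_ω` by a constant, and the variance is
at most the mean square of the shifted coefficient (`complexVariance_coeff_le_integral`).

A 2-design reproduces the Haar twirl `E[W†AW ⊗ W†BW]`, which commutes with all `X ⊗ X` and is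
therefore a combination of identity and swap; two traces fix the coefficients
(`IsTwoDesign.exists_twirl`). Averaging over the last layer gives exactly `‖O₀‖² / (d² - 1) · e(ω)`,
with `e(ω)` (`excess`) the mean squared norm of the traceless part of `D_ω`.

Averaging over one earlier layer expresses `e(ω)` through the values of `e` for one layer fewer at
the frequencies `ω - λ_j + λ_{j'}`, with nonnegative weights that sum to 1 and are at most `1/(d² -
1)` (`excess_succ`). So `e ≤ 1`, which yields the second claim, and `e(ω) ≤ |R(ω)| / (d² - 1)^L`
(`excess_le`). Replacing `d² - 1` by `d²` costs a factor `(d²/(d² - 1))^(L+1)`, bounded when `L ≤ κ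
d²` (`div_pow_le_exp`); this yields the first claim. -/

namespace QFM

/-! ### The commutant of `X ⊗ X`. -/

section Twirl

variable {ι : Type*} [Fintype ι] [DecidableEq ι]

/-- A four-index tensor that is invariant under `X ⊗ X` for every unitary `X`. -/
def IsUnitarilyInvariant (T : ι → ι → ι → ι → ℂ) : Prop :=
  ∀ X ∈ Matrix.unitaryGroup ι ℂ, ∀ i j k l,
    T i j k l = ∑ p, ∑ q, ∑ r, ∑ s, star (X p i) * X q j * star (X r k) * X s l * T p q r s

lemma diagonal_mem_unitaryGroup {x : ι → ℂ} (hx : ∀ i, x i * star (x i) = 1) :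
    Matrix.diagonal x ∈ Matrix.unitaryGroup ι ℂ := by
  rw [Matrix.mem_unitaryGroup_iff, Matrix.star_eq_conjTranspose, Matrix.diagonal_conjTranspose,
    Matrix.diagonal_mul_diagonal, ← Matrix.diagonal_one]
  congr 1
  funext i
  exact hx i

lemma permMatrix_mem_unitaryGroup (σ : Equiv.Perm ι) :
    σ.permMatrix ℂ ∈ Matrix.unitaryGroup ι ℂ := by
  rw [Matrix.mem_unitaryGroup_iff, Matrix.star_eq_conjTranspose, Matrix.conjTranspose_permMatrix,
    ← Matrix.permMatrix_mul]
  simp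

/-- A rotation in the plane of two coordinates `p ≠ q`. -/
lemma exists_unitary_rotation {p q : ι} (h : p ≠ q) :
    ∃ X ∈ Matrix.unitaryGroup ι ℂ, ∀ a,
      X a p = if a = p then (-3 / 5 : ℂ) else if a = q then 4 / 5 else 0 := by
  set w : ι → ℂ := fun a => if a = p then 2 else if a = q then -1 else 0 with hw
  have hww : w ⬝ᵥ w = 5 := by
    have : ∀ a, w a * w a = (if a = p then 4 else 0) + (if a = q then 1 else 0) := by
      intro a
      by_cases hp : a = p
      · subst hp; simp [hw, h]; norm_num
      · by_cases hq : a = q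
        · subst hq; simp [hw, hp]
        · simp [hw, hp, hq]
    simp only [dotProduct, this, Finset.sum_add_distrib]
    simp
    norm_num
  -- The Householder reflection along `w = 2e_p - e_q`, with `2/5 = 2/‖w‖²`; the 3-4-5 triangle
  -- keeps its entries rational.
  refine ⟨1 - (2 / 5 : ℂ) • Matrix.vecMulVec w w, ?_, fun a => ?_⟩
  · have hs : star w = w := by
      funext a
      simp only [Pi.star_apply, hw]
      split_ifs <;> simp
    rw [Matrix.mem_unitaryGroup_iff, Matrix.star_eq_conjTranspose, Matrix.conjTranspose_sub,
      Matrix.conjTranspose_smul, Matrix.conjTranspose_vecMulVec, hs, Matrix.conjTranspose_one]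
    have hc : star (2 / 5 : ℂ) = 2 / 5 := by simp
    have hm : Matrix.vecMulVec w w * Matrix.vecMulVec w w = (5 : ℂ) • Matrix.vecMulVec w w := by
      rw [Matrix.vecMulVec_mul_vecMulVec, hww]
      ext a b
      simp [Matrix.vecMulVec_apply]
      ring
    rw [hc, sub_mul, mul_sub, mul_sub, Matrix.smul_mul, Matrix.smul_mul, Matrix.mul_smul,
      Matrix.mul_smul, hm]
    ext a b
    simp
    ring
  · by_cases hp : a = p
    · subst hp; simp [hw, Matrix.vecMulVec_apply]; norm_num
    · by_cases hq : a = q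
      · subst hq; simp [hw, hp, Matrix.vecMulVec_apply]; norm_num
      · simp [hw, hp, hq, Matrix.vecMulVec_apply]

/-- Invariance under diagonal unitaries. If `{i, k}` and `{j, l}` differ as multisets, a phase `I`
at a suitable single index multiplies the entry by `I`, `-I` or `-1`, so the entry vanishes. -/
lemma IsUnitarilyInvariant.support {T : ι → ι → ι → ι → ℂ} (hT : IsUnitarilyInvariant T)
    {i j k l : ι} (h₁ : ¬(i = j ∧ k = l)) (h₂ : ¬(i = l ∧ j = k)) : T i j k l = 0 := by
  have key : ∀ x : ι → ℂ, (∀ i, x i * star (x i) = 1) →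
      T i j k l = star (x i) * x j * star (x k) * x l * T i j k l := by
    intro x hx
    have := hT _ (diagonal_mem_unitaryGroup hx) i j k l
    simpa [Matrix.diagonal_apply, apply_ite, Finset.sum_ite_eq, ite_mul, mul_ite] using this
  have hI : ∀ m i : ι, (if i = m then Complex.I else 1) *
      star (if i = m then Complex.I else 1 : ℂ) = 1 := by
    intro m i
    split_ifs <;> simp
  have fin1 : ∀ t : ℂ, t = Complex.I * t → t = 0 := by
    intro t ht
    have h0 : (1 - Complex.I) * t = 0 := by linear_combination ht
    rcases mul_eq_zero.mp h0 with h | h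
    · have := congrArg Complex.re h; simp at this
    · exact h
  have fin2 : ∀ t : ℂ, t = -(Complex.I * t) → t = 0 := by
    intro t ht
    have h0 : (1 + Complex.I) * t = 0 := by linear_combination ht
    rcases mul_eq_zero.mp h0 with h | h
    · have := congrArg Complex.re h; simp at this
    · exact h
  have fin3 : ∀ t : ℂ, t = -t → t = 0 := fun t ht => by linear_combination ht / 2
  by_cases hij : i = j
  · subst hij
    have hkl : ¬ l = k := fun h => h₁ ⟨rfl, h.symm⟩
    have := key _ (hI k)
    by_cases hik : i = k
    · subst hik; simp [hkl] at this; exact fin2 _ this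
    · simp [hkl, hik] at this; exact fin2 _ this
  · by_cases hil : i = l
    · subst hil
      have hjk : ¬ k = j := fun h => h₂ ⟨rfl, h.symm⟩
      have := key _ (hI j)
      simp [hij, hjk] at this
      exact fin1 _ this
    · have := key _ (hI i)
      by_cases hik : k = i
      · subst hik
        simp [Ne.symm hij, Ne.symm hil] at this
        exact fin3 _ this
      · simp [Ne.symm hij, Ne.symm hil, hik] at this
        exact fin2 _ this

lemma IsUnitarilyInvariant.perm {T : ι → ι → ι → ι → ℂ} (hT : IsUnitarilyInvariant T)
    (σ : Equiv.Perm ι) (i j k l : ι) : T (σ i) (σ j) (σ k) (σ l) = T i j k l := by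
  rw [hT _ (permMatrix_mem_unitaryGroup σ) (σ i) (σ j) (σ k) (σ l)]
  simp [Equiv.Perm.permMatrix, PEquiv.toMatrix_apply, apply_ite, ite_mul]

/-- Phases and permutations leave three free values; a unitary mixing two coordinates ties them
together. With first-column entries `c = -3/5`, `s = 4/5`, invariance reads `(1 - c⁴ - s⁴) T_pppp =
2c²s² (T_ppqq + T_pqqp)`, and `1 - c⁴ - s⁴ = 2c²s²`. -/
lemma IsUnitarilyInvariant.diag {T : ι → ι → ι → ι → ℂ} (hT : IsUnitarilyInvariant T)
    {p q : ι} (h : p ≠ q) : T p p p p = T p p q q + T p q q p := by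
  obtain ⟨X, hX, hXp⟩ := exists_unitary_rotation h
  have e := hT X hX p p p p
  have hsum : ∀ f : ι → ℂ, ∑ a, X a p * f a = -3 / 5 * f p + 4 / 5 * f q := by
    intro f
    have : ∀ a, X a p * f a =
        (if a = p then -3 / 5 * f a else 0) + (if a = q then 4 / 5 * f a else 0) := by
      intro a
      rw [hXp]
      by_cases hp : a = p
      · subst hp; simp [h]
      · simp [hp]
    simp only [this, Finset.sum_add_distrib]
    simp
  have hstar : ∀ a, star (X a p) = X a p := by
    intro a
    rw [hXp]
    split_ifs <;> simp
  simp only [hstar, mul_assoc, ← Finset.mul_sum, hsum] at e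
  have z : ∀ a b c d, ¬(a = b ∧ c = d) → ¬(a = d ∧ b = c) → T a b c d = 0 :=
    fun a b c d h₁ h₂ => hT.support h₁ h₂
  rw [z p p p q (by simp [h]) (by simp [h]), z p p q p (by simp [h.symm]) (by simp [h]),
    z p q p p (by simp [h]) (by simp [h.symm]), z q p p p (by simp [h.symm]) (by simp [h.symm]),
    z p q p q (by simp [h]) (by simp [h]), z q p q p (by simp [h.symm]) (by simp [h.symm]),
    z q q q p (by simp [h.symm]) (by simp [h.symm]), z q q p q (by simp [h]) (by simp [h.symm]),
    z q p q q (by simp [h.symm]) (by simp [h]), z p q q q (by simp [h]) (by simp [h])] at e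
  have s₁ : T q q q q = T p p p p := by
    simpa using hT.perm (Equiv.swap p q) p p p p
  have s₂ : T q q p p = T p p q q := by
    simpa using hT.perm (Equiv.swap p q) p p q q
  have s₃ : T q p p q = T p q q p := by
    simpa using hT.perm (Equiv.swap p q) p q q p
  rw [s₁, s₂, s₃] at e
  -- `288/625` is `2c²s²`.
  linear_combination (625 / 288) * e

/-- The commutant of `{X ⊗ X}` is spanned by the identity and the swap. -/
theorem IsUnitarilyInvariant.exists_eq [Nontrivial ι] {T : ι → ι → ι → ι → ℂ}
    (hT : IsUnitarilyInvariant T) : ∃ a b : ℂ, ∀ i j k l, T i j k l =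
      a * (if i = j ∧ k = l then 1 else 0) + b * (if i = l ∧ j = k then 1 else 0) := by
  obtain ⟨p, q, hpq⟩ := exists_pair_ne ι
  refine ⟨T p p q q, T p q q p, fun i j k l => ?_⟩
  -- Permutations act transitively on ordered pairs of distinct indices, so one pair determines both
  -- values.
  have two : ∀ {i k : ι}, i ≠ k → T i i k k = T p p q q ∧ T i k k i = T p q q p := by
    intro i k hik
    obtain ⟨σ, hσi, hσk⟩ := MulAction.is_two_pretransitive_iff.mp
      (Equiv.Perm.isMultiplyPretransitive ι 2) hpq hik
    rw [Equiv.Perm.smul_def] at hσi hσk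
    subst hσi hσk
    exact ⟨hT.perm σ p p q q, hT.perm σ p q q p⟩
  by_cases h₁ : i = j ∧ k = l
  · obtain ⟨rfl, rfl⟩ := h₁
    by_cases hik : i = k
    · subst hik
      obtain ⟨m, hm⟩ := exists_ne i
      rw [hT.diag hm.symm, (two hm.symm).1, (two hm.symm).2]
      simp
    · simp [hik, (two hik).1]
  · by_cases h₂ : i = l ∧ j = k
    · obtain ⟨rfl, rfl⟩ := h₂
      have hij : i ≠ j := fun h => h₁ ⟨h, h.symm⟩
      simp [hij, (two hij).2]
    · rw [hT.support h₁ h₂]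
      simp [h₁, h₂]

end Twirl

/-! ### Haar measure and the twirl of a 2-design. -/

section Design

variable {d : ℕ} {Θ : Type*} [MeasurableSpace Θ]

instance instIsProbabilityMeasureHaarU (d : ℕ) : IsProbabilityMeasure (haarU d) := by
  constructor
  simpa [haarU] using Measure.haarMeasure_self (K₀ := (⊤ : TopologicalSpace.PositiveCompacts (U d)))

instance instIsHaarMeasureHaarU (d : ℕ) : (haarU d).IsHaarMeasure := by
  unfold haarU
  infer_instance

instance instSecondCountableU (d : ℕ) : SecondCountableTopology (U d) := by
  have : SecondCountableTopology (Matrix (Fin d) (Fin d) ℂ) :=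
    inferInstanceAs (SecondCountableTopology (Fin d → Fin d → ℂ))
  exact TopologicalSpace.Subtype.secondCountableTopology _

/-- The unitary group is unimodular. -/
instance instIsMulRightInvariantHaarU (d : ℕ) : (haarU d).IsMulRightInvariant where
  map_mul_right_eq_self g := by
    -- Right translations commute with left ones, so the pushforward is again a Haar probability
    -- measure and uniqueness applies.
    have : IsProbabilityMeasure (Measure.map (· * g) (haarU d)) :=
      Measure.isProbabilityMeasure_map (measurable_mul_const g).aemeasurable
    exact Measure.isHaarMeasure_eq_of_isProbabilityMeasure _ _

lemma integrable_continuous_comp {K : Type*} [TopologicalSpace K] [CompactSpace K]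
    [MeasurableSpace K] [OpensMeasurableSpace K] {μ : Measure Θ} [IsFiniteMeasure μ] {Z : Θ → K}
    (hZ : Measurable Z) {g : K → ℂ} (hg : Continuous g) : Integrable (fun θ => g (Z θ)) μ := by
  obtain ⟨C, hC⟩ := isCompact_univ.exists_bound_of_continuousOn hg.continuousOn
  exact Integrable.of_bound (hg.measurable.comp hZ).aestronglyMeasurable C
    (Filter.Eventually.of_forall fun θ => hC _ (Set.mem_univ _))

lemma continuous_entry (i j : Fin d) : Continuous fun V : U d => (V : Matrix _ _ ℂ) i j :=
  continuous_subtype_val.matrix_elem i j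

/-- The conjugate `V† A V`. -/
noncomputable def conjBy (A : Matrix (Fin d) (Fin d) ℂ) (V : U d) : Matrix (Fin d) (Fin d) ℂ :=
  (V : Matrix _ _ ℂ)ᴴ * A * (V : Matrix _ _ ℂ)

lemma continuous_conjBy (A : Matrix (Fin d) (Fin d) ℂ) : Continuous (conjBy A) := by
  unfold conjBy
  fun_prop

lemma conjBy_apply (A : Matrix (Fin d) (Fin d) ℂ) (V : U d) (i j : Fin d) :
    conjBy A V i j =
      ∑ p, ∑ q, star ((V : Matrix _ _ ℂ) p i) * A p q * (V : Matrix _ _ ℂ) q j := by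
  simp only [conjBy, Matrix.mul_apply, Matrix.conjTranspose_apply, Finset.sum_mul]
  exact Finset.sum_comm

lemma conjBy_mul (A : Matrix (Fin d) (Fin d) ℂ) (V X : U d) :
    conjBy A (V * X) = conjBy (conjBy A V) X := by
  simp [conjBy, Matrix.mul_assoc]

lemma conjBy_trace (A : Matrix (Fin d) (Fin d) ℂ) (V : U d) : (conjBy A V).trace = A.trace := by
  have h : V.1 * V.1ᴴ = 1 := Matrix.mem_unitaryGroup_iff.mp V.2
  rw [conjBy, Matrix.trace_mul_comm, ← Matrix.mul_assoc, h, Matrix.one_mul]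

lemma conjBy_mul_conjBy (A B : Matrix (Fin d) (Fin d) ℂ) (V : U d) :
    conjBy A V * conjBy B V = conjBy (A * B) V := by
  have h : V.1 * V.1ᴴ = 1 := Matrix.mem_unitaryGroup_iff.mp V.2
  calc conjBy A V * conjBy B V = (V : Matrix _ _ ℂ)ᴴ * A *
        ((V : Matrix _ _ ℂ) * (V : Matrix _ _ ℂ)ᴴ) * B * (V : Matrix _ _ ℂ) := by
        simp only [conjBy, Matrix.mul_assoc]
    _ = conjBy (A * B) V := by
        rw [h]
        simp only [conjBy, Matrix.mul_assoc, Matrix.one_mul]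

/-- The entries of `E[W† A W ⊗ W† B W]`. -/
noncomputable def twirl (μ : Measure Θ) (W : Θ → U d) (A B : Matrix (Fin d) (Fin d) ℂ)
    (i j k l : Fin d) : ℂ :=
  ∫ θ, conjBy A (W θ) i j * conjBy B (W θ) k l ∂μ

lemma integrable_conjBy_mul {μ : Measure Θ} [IsFiniteMeasure μ] {W : Θ → U d}
    (hW : Measurable W) (A B : Matrix (Fin d) (Fin d) ℂ) (i j k l : Fin d) :
    Integrable (fun θ => conjBy A (W θ) i j * conjBy B (W θ) k l) μ :=
  integrable_continuous_comp (g := fun V => conjBy A V i j * conjBy B V k l) hW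
    (((continuous_conjBy A).matrix_elem i j).mul ((continuous_conjBy B).matrix_elem k l))

/-- The twirl is linear in the second moment, so a 2-design cannot be distinguished from Haar
measure by it. -/
lemma twirl_eq_sum_secondMoment {μ : Measure Θ} [IsFiniteMeasure μ] {W : Θ → U d}
    (hW : Measurable W) (A B : Matrix (Fin d) (Fin d) ℂ) (i j k l : Fin d) :
    twirl μ W A B i j k l = ∑ p, ∑ q, ∑ r, ∑ s,
      A p q * B r s * secondMoment μ W ((q, s), (p, r)) ((j, l), (i, k)) := by
  have hint : ∀ p q r s, Integrable (fun θ =>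
      A p q * B r s * tensorTwoTwo (W θ) ((q, s), (p, r)) ((j, l), (i, k))) μ := by
    intro p q r s
    refine integrable_continuous_comp (g := fun V : U d =>
      A p q * B r s * tensorTwoTwo V ((q, s), (p, r)) ((j, l), (i, k))) hW ?_
    simp only [tensorTwoTwo, Matrix.kroneckerMap_apply, Matrix.map_apply]
    exact continuous_const.mul (((continuous_entry _ _).mul (continuous_entry _ _)).mul
      ((continuous_entry _ _).star.mul (continuous_entry _ _).star))
  have hpt : ∀ θ, conjBy A (W θ) i j * conjBy B (W θ) k l = ∑ p, ∑ q, ∑ r, ∑ s,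
      A p q * B r s * tensorTwoTwo (W θ) ((q, s), (p, r)) ((j, l), (i, k)) := by
    intro θ
    simp only [conjBy_apply, Finset.sum_mul, tensorTwoTwo, Matrix.kroneckerMap_apply,
      Matrix.map_apply]
    simp only [Finset.mul_sum]
    refine Finset.sum_congr rfl fun p _ => Finset.sum_congr rfl fun q _ =>
      Finset.sum_congr rfl fun r _ => Finset.sum_congr rfl fun s _ => ?_
    ring
  simp only [twirl, hpt, secondMoment, Matrix.of_apply]
  rw [integral_finsetSum _ fun p _ => integrable_finsetSum _ fun q _ =>
    integrable_finsetSum _ fun r _ => integrable_finsetSum _ fun s _ => hint p q r s]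
  refine Finset.sum_congr rfl fun p _ => ?_
  rw [integral_finsetSum _ fun q _ =>
    integrable_finsetSum _ fun r _ => integrable_finsetSum _ fun s _ => hint p q r s]
  refine Finset.sum_congr rfl fun q _ => ?_
  rw [integral_finsetSum _ fun r _ => integrable_finsetSum _ fun s _ => hint p q r s]
  refine Finset.sum_congr rfl fun r _ => ?_
  rw [integral_finsetSum _ fun s _ => hint p q r s]
  exact Finset.sum_congr rfl fun s _ => integral_const_mul _ _

lemma IsTwoDesign.twirl_eq {μ : Measure Θ} [IsFiniteMeasure μ] {W : Θ → U d}
    (hW : Measurable W) (h : IsTwoDesign μ W) (A B : Matrix (Fin d) (Fin d) ℂ) :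
    twirl μ W A B = twirl (haarU d) id A B := by
  funext i j k l
  rw [twirl_eq_sum_secondMoment hW, twirl_eq_sum_secondMoment measurable_id,
    sub_eq_zero.mp h]

/-- Substituting `V * X` for `V`, by right invariance of Haar measure, conjugates both factors by
`X`. -/
lemma isUnitarilyInvariant_twirl_haarU (A B : Matrix (Fin d) (Fin d) ℂ) :
    IsUnitarilyInvariant (twirl (haarU d) id A B) := by
  intro X hX i j k l
  have hint := integrable_conjBy_mul (μ := haarU d) measurable_id A B
  have hpt : ∀ V : U d, conjBy A (V * ⟨X, hX⟩) i j * conjBy B (V * ⟨X, hX⟩) k l =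
      ∑ p, ∑ q, ∑ r, ∑ s, star (X p i) * X q j * star (X r k) * X s l *
        (conjBy A V p q * conjBy B V r s) := by
    intro V
    simp only [conjBy_mul, conjBy_apply _ (⟨X, hX⟩ : U d), Finset.sum_mul]
    simp only [Finset.mul_sum]
    refine Finset.sum_congr rfl fun p _ => Finset.sum_congr rfl fun q _ =>
      Finset.sum_congr rfl fun r _ => Finset.sum_congr rfl fun s _ => ?_
    ring
  have hint' : ∀ p q r s, Integrable (fun V : U d => star (X p i) * X q j * star (X r k) * X s l *
        (conjBy A V p q * conjBy B V r s)) (haarU d) := fun p q r s => (hint p q r s).const_mul _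
  simp only [twirl, id]
  rw [← integral_mul_right_eq_self _ (⟨X, hX⟩ : U d)]
  simp only [hpt]
  rw [integral_finsetSum _ fun p _ => integrable_finsetSum _ fun q _ =>
    integrable_finsetSum _ fun r _ => integrable_finsetSum _ fun s _ => hint' p q r s]
  refine Finset.sum_congr rfl fun p _ => ?_
  rw [integral_finsetSum _ fun q _ =>
    integrable_finsetSum _ fun r _ => integrable_finsetSum _ fun s _ => hint' p q r s]
  refine Finset.sum_congr rfl fun q _ => ?_
  rw [integral_finsetSum _ fun r _ => integrable_finsetSum _ fun s _ => hint' p q r s]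
  refine Finset.sum_congr rfl fun r _ => ?_
  rw [integral_finsetSum _ fun s _ => hint' p q r s]
  exact Finset.sum_congr rfl fun s _ => integral_const_mul _ _

lemma sum_twirl_diag {μ : Measure Θ} [IsProbabilityMeasure μ] {W : Θ → U d} (hW : Measurable W)
    (A B : Matrix (Fin d) (Fin d) ℂ) :
    ∑ i, ∑ k, twirl μ W A B i i k k = A.trace * B.trace := by
  have hint := integrable_conjBy_mul (μ := μ) hW A B
  have : ∑ i, ∑ k, twirl μ W A B i i k k =
      ∫ θ, (conjBy A (W θ)).trace * (conjBy B (W θ)).trace ∂μ := by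
    simp only [Matrix.trace, Matrix.diag_apply, Finset.sum_mul_sum]
    rw [integral_finsetSum _ fun i _ => integrable_finsetSum _ fun k _ => hint i i k k]
    refine Finset.sum_congr rfl fun i _ => ?_
    rw [integral_finsetSum _ fun k _ => hint i i k k]
    rfl
  rw [this]
  simp [conjBy_trace]

lemma sum_twirl_swap {μ : Measure Θ} [IsProbabilityMeasure μ] {W : Θ → U d} (hW : Measurable W)
    (A B : Matrix (Fin d) (Fin d) ℂ) :
    ∑ i, ∑ k, twirl μ W A B i k k i = (A * B).trace := by
  have hint := integrable_conjBy_mul (μ := μ) hW A B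
  have : ∑ i, ∑ k, twirl μ W A B i k k i =
      ∫ θ, (conjBy A (W θ) * conjBy B (W θ)).trace ∂μ := by
    simp only [Matrix.trace, Matrix.diag_apply, Matrix.mul_apply]
    rw [integral_finsetSum _ fun i _ => integrable_finsetSum _ fun k _ => hint i k k i]
    refine Finset.sum_congr rfl fun i _ => ?_
    rw [integral_finsetSum _ fun k _ => hint i k k i]
    rfl
  rw [this]
  simp [conjBy_mul_conjBy, conjBy_trace]

/-- The twirl over a `2`-design is a combination of the identity and the swap, with coefficients
determined by the two traces. -/
theorem IsTwoDesign.exists_twirl {μ : Measure Θ} [IsProbabilityMeasure μ] {W : Θ → U d}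
    (hd : 2 ≤ d) (hW : Measurable W) (h : IsTwoDesign μ W) (A B : Matrix (Fin d) (Fin d) ℂ) :
    ∃ a b : ℂ, (∀ i j k l, twirl μ W A B i j k l =
        a * (if i = j ∧ k = l then 1 else 0) + b * (if i = l ∧ j = k then 1 else 0)) ∧
      a * d ^ 2 + b * d = A.trace * B.trace ∧ a * d + b * d ^ 2 = (A * B).trace := by
  have : Nontrivial (Fin d) := Fin.nontrivial_iff_two_le.mpr hd
  obtain ⟨a, b, hab⟩ := (isUnitarilyInvariant_twirl_haarU A B).exists_eq
  rw [← h.twirl_eq hW] at hab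
  refine ⟨a, b, hab, ?_, ?_⟩
  · rw [← sum_twirl_diag (μ := μ) hW A B]
    simp only [hab, and_self, if_true, Finset.sum_add_distrib, ← Finset.mul_sum]
    simp
    exact Or.inl (by ring)
  · rw [← sum_twirl_swap (μ := μ) hW A B]
    simp only [hab, and_self, if_true, Finset.sum_add_distrib, ← Finset.mul_sum]
    have : ∀ i k : Fin d, (i = k ∧ k = i) = (i = k) := fun i k => by
      ext; constructor
      · exact fun h => h.1
      · exact fun h => ⟨h, h.symm⟩
    simp [this]
    exact Or.inl (by ring)

end Design

/-! ### Frequency components of the state: layer recursion, trace and norm. -/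

section FreqOp

variable {d L : ℕ}

/-- A resolution of the identity into rank one orthogonal projections. -/
structure IsRankOneResolution (P : Fin d → Matrix (Fin d) (Fin d) ℂ) : Prop where
  herm : ∀ j, (P j)ᴴ = P j
  mul_self : ∀ j, P j * P j = P j
  mul_of_ne : ∀ j k, j ≠ k → P j * P k = 0
  sum_eq_one : ∑ j, P j = 1
  trace_eq_one : ∀ j, (P j).trace = 1

/-- The squared Schatten 2-norm. -/
noncomputable def frobSq (A : Matrix (Fin d) (Fin d) ℂ) : ℝ := ∑ i, ∑ j, ‖A i j‖ ^ 2

lemma frobSq_nonneg (A : Matrix (Fin d) (Fin d) ℂ) : 0 ≤ frobSq A :=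
  Finset.sum_nonneg fun _ _ => Finset.sum_nonneg fun _ _ => sq_nonneg _

lemma ofReal_frobSq (A : Matrix (Fin d) (Fin d) ℂ) : (frobSq A : ℂ) = (A * Aᴴ).trace := by
  simp only [frobSq, Matrix.trace, Matrix.diag_apply, Matrix.mul_apply,
    Matrix.conjTranspose_apply, Complex.star_def, Complex.mul_conj']
  push_cast
  rfl

/-- The frequency of a pair of paths. -/
noncomputable def pathFreq (lam : Fin L → Fin d → ℝ) (p : (Fin L → Fin d) × (Fin L → Fin d)) : ℝ :=
  ∑ l, lam l (p.1 l) - ∑ l, lam l (p.2 l)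

/-- The product of projections and unitaries along a path. -/
noncomputable def pathProd (P : Fin L → Fin d → Matrix (Fin d) (Fin d) ℂ) (V : Fin L → U d)
    (J : Fin L → Fin d) : Matrix (Fin d) (Fin d) ℂ :=
  orderedProd L fun l => P l (J l) * (V l : Matrix _ _ ℂ)

/-- The frequency `ω` component of the state `ρ` sent through the circuit. -/
noncomputable def freqOp (lam : Fin L → Fin d → ℝ) (P : Fin L → Fin d → Matrix (Fin d) (Fin d) ℂ)
    (ρ : Matrix (Fin d) (Fin d) ℂ) (ω : ℝ) (V : Fin L → U d) : Matrix (Fin d) (Fin d) ℂ :=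
  ∑ p, if pathFreq lam p = ω then pathProd P V p.2 * ρ * (pathProd P V p.1)ᴴ else 0

/-- The number of pairs of paths with frequency `ω`. -/
noncomputable def freqCount (lam : Fin L → Fin d → ℝ) (ω : ℝ) : ℝ :=
  ∑ p, if pathFreq lam p = ω then 1 else 0

lemma freqCount_nonneg (lam : Fin L → Fin d → ℝ) (ω : ℝ) : 0 ≤ freqCount lam ω :=
  Finset.sum_nonneg fun _ _ => by split_ifs <;> norm_num

lemma sum_pairs_succ {M ι : Type*} [AddCommMonoid M] [Fintype ι]
    (f : (Fin (L + 1) → ι) × (Fin (L + 1) → ι) → M) :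
    ∑ p, f p = ∑ j, ∑ j', ∑ p : (Fin L → ι) × (Fin L → ι),
      f (Fin.snoc (α := fun _ => ι) p.1 j, Fin.snoc (α := fun _ => ι) p.2 j') := by
  simp only [Fintype.sum_prod_type]
  rw [← (Fin.snocEquiv fun _ : Fin (L + 1) => ι).sum_comp, Fintype.sum_prod_type]
  refine Finset.sum_congr rfl fun j _ => ?_
  rw [Finset.sum_comm, ← (Fin.snocEquiv fun _ : Fin (L + 1) => ι).sum_comp,
    Fintype.sum_prod_type]
  refine Finset.sum_congr rfl fun j' _ => ?_
  rw [Finset.sum_comm]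
  rfl

/-- Peeling off the last layer shifts the target frequency by an eigenvalue difference; every
recursion over `L` rests on this. -/
lemma pathFreq_snoc (lam : Fin (L + 1) → Fin d → ℝ) (p : (Fin L → Fin d) × (Fin L → Fin d))
    (j j' : Fin d) (ω : ℝ) :
    pathFreq lam (Fin.snoc (α := fun _ => Fin d) p.1 j, Fin.snoc (α := fun _ => Fin d) p.2 j') = ω ↔
      pathFreq (fun l => lam l.castSucc) p = ω - lam (Fin.last L) j + lam (Fin.last L) j' := by
  simp only [pathFreq, Fin.sum_univ_castSucc, Fin.snoc_castSucc, Fin.snoc_last]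
  constructor <;> intro h <;> linarith

lemma freqCount_succ (lam : Fin (L + 1) → Fin d → ℝ) (ω : ℝ) :
    freqCount lam ω = ∑ j, ∑ j', freqCount (fun l => lam l.castSucc)
      (ω - lam (Fin.last L) j + lam (Fin.last L) j') := by
  simp only [freqCount, sum_pairs_succ (L := L), pathFreq_snoc]

lemma freqOp_succ (lam : Fin (L + 1) → Fin d → ℝ)
    (P : Fin (L + 1) → Fin d → Matrix (Fin d) (Fin d) ℂ) (hP : ∀ l, IsRankOneResolution (P l))
    (ρ : Matrix (Fin d) (Fin d) ℂ) (ω : ℝ) (V : Fin (L + 1) → U d) :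
    freqOp lam P ρ ω V = ∑ j, ∑ j', P (Fin.last L) j' * ((V (Fin.last L) : Matrix _ _ ℂ) *
      freqOp (fun l => lam l.castSucc) (fun l => P l.castSucc) ρ
        (ω - lam (Fin.last L) j + lam (Fin.last L) j') (fun l => V l.castSucc) *
      (V (Fin.last L) : Matrix _ _ ℂ)ᴴ) * P (Fin.last L) j := by
  simp only [freqOp, sum_pairs_succ (L := L), pathFreq_snoc]
  refine Finset.sum_congr rfl fun j _ => Finset.sum_congr rfl fun j' _ => ?_
  simp only [Finset.mul_sum, Finset.sum_mul]
  refine Finset.sum_congr rfl fun p _ => ?_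
  split_ifs with h
  · simp only [pathProd, orderedProd, Fin.snoc_castSucc, Fin.snoc_last,
      Matrix.conjTranspose_mul, (hP _).herm, Matrix.mul_assoc]
  · simp

lemma freqOp_zero (lam : Fin 0 → Fin d → ℝ) (P : Fin 0 → Fin d → Matrix (Fin d) (Fin d) ℂ)
    (ρ : Matrix (Fin d) (Fin d) ℂ) (ω : ℝ) (V : Fin 0 → U d) :
    freqOp lam P ρ ω V = if ω = 0 then ρ else 0 := by
  simp [freqOp, pathFreq, pathProd, orderedProd, eq_comm]

lemma freqCount_zero (lam : Fin 0 → Fin d → ℝ) (ω : ℝ) :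
    freqCount lam ω = if ω = 0 then 1 else 0 := by
  simp [freqCount, pathFreq, eq_comm]

lemma trace_unitary_conj (A : Matrix (Fin d) (Fin d) ℂ) (V : U d) :
    ((V : Matrix _ _ ℂ) * A * (V : Matrix _ _ ℂ)ᴴ).trace = A.trace := by
  have h : V.1ᴴ * V.1 = 1 := Matrix.mem_unitaryGroup_iff'.mp V.2
  rw [Matrix.trace_mul_comm, ← Matrix.mul_assoc, h, Matrix.one_mul]

lemma IsRankOneResolution.trace_mul_mul {P : Fin d → Matrix (Fin d) (Fin d) ℂ}
    (hP : IsRankOneResolution P) (A : Matrix (Fin d) (Fin d) ℂ) (j j' : Fin d) :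
    (P j' * A * P j).trace = if j' = j then (A * P j).trace else 0 := by
  rw [Matrix.mul_assoc, Matrix.trace_mul_comm, Matrix.mul_assoc]
  split_ifs with h
  · subst h
    rw [hP.mul_self]
  · rw [hP.mul_of_ne _ _ (Ne.symm h), Matrix.mul_zero, Matrix.trace_zero]

/-- Blocks `P_{j'} X P_j` with `j ≠ j'` have trace zero. Those with `j = j'` leave the frequency
unchanged, and their traces add up to `tr X` since the projections sum to 1. -/
theorem trace_freqOp {ρ : Matrix (Fin d) (Fin d) ℂ} (hρ : ρ.trace = 1) :
    ∀ {L : ℕ} (lam : Fin L → Fin d → ℝ) (P : Fin L → Fin d → Matrix (Fin d) (Fin d) ℂ)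
      (_ : ∀ l, IsRankOneResolution (P l)) (ω : ℝ) (V : Fin L → U d),
      (freqOp lam P ρ ω V).trace = if ω = 0 then 1 else 0
  | 0, lam, P, _, ω, V => by
    rw [freqOp_zero]
    split_ifs <;> simp [hρ]
  | L + 1, lam, P, hP, ω, V => by
    rw [freqOp_succ lam P hP]
    simp only [Matrix.trace_sum, (hP _).trace_mul_mul, Finset.sum_ite_eq', Finset.mem_univ, if_true,
      sub_add_cancel]
    rw [← Matrix.trace_sum, ← Finset.mul_sum, (hP _).sum_eq_one, Matrix.mul_one,
      trace_unitary_conj, trace_freqOp hρ _ _ fun l => hP l.castSucc]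

/-- The blocks `P_{j'} · P_j` are mutually orthogonal for the Hilbert–Schmidt product, so no cross
terms remain. Moving the last unitary onto the projections leaves `D` dependent on the earlier
layers alone, ready for the twirl. -/
theorem frobSq_freqOp_succ (lam : Fin (L + 1) → Fin d → ℝ)
    (P : Fin (L + 1) → Fin d → Matrix (Fin d) (Fin d) ℂ) (hP : ∀ l, IsRankOneResolution (P l))
    (ρ : Matrix (Fin d) (Fin d) ℂ) (ω : ℝ) (V : Fin (L + 1) → U d)
    (D : ℝ → Matrix (Fin d) (Fin d) ℂ)
    (hD : D = fun ν => freqOp (fun l => lam l.castSucc) (fun l => P l.castSucc) ρ ν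
      fun l => V l.castSucc) :
    (frobSq (freqOp lam P ρ ω V) : ℂ) = ∑ j, ∑ j',
      (conjBy (P (Fin.last L) j') (V (Fin.last L)) *
        D (ω - lam (Fin.last L) j + lam (Fin.last L) j') *
        conjBy (P (Fin.last L) j) (V (Fin.last L)) *
        (D (ω - lam (Fin.last L) j + lam (Fin.last L) j'))ᴴ).trace := by
  have hQ := hP (Fin.last L)
  set Q := P (Fin.last L)
  set v := (V (Fin.last L) : Matrix (Fin d) (Fin d) ℂ) with hv
  set X : Fin d → Fin d → Matrix (Fin d) (Fin d) ℂ := fun j j' =>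
    v * D (ω - lam (Fin.last L) j + lam (Fin.last L) j') * vᴴ with hX
  set E := freqOp lam P ρ ω V with hE
  have hEX : E = ∑ j, ∑ j', Q j' * X j j' * Q j := by
    rw [hE, freqOp_succ lam P hP]
    simp only [hX, hD]
    rfl
  have hblock : ∀ j j', Q j' * E * Q j = Q j' * X j j' * Q j := by
    intro j j'
    rw [hEX]
    simp only [Finset.mul_sum, Finset.sum_mul]
    rw [Finset.sum_eq_single j, Finset.sum_eq_single j']
    · rw [Matrix.mul_assoc, Matrix.mul_assoc, hQ.mul_self, ← Matrix.mul_assoc, ← Matrix.mul_assoc,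
        hQ.mul_self]
    · intro k _ hk
      rw [← Matrix.mul_assoc, ← Matrix.mul_assoc, hQ.mul_of_ne _ _ hk.symm]
      simp
    · simp
    · intro k _ hk
      refine Finset.sum_eq_zero fun k' _ => ?_
      rw [Matrix.mul_assoc, Matrix.mul_assoc, hQ.mul_of_ne _ _ hk]
      simp
    · simp
  rw [ofReal_frobSq]
  nth_rewrite 1 [hEX]
  simp only [Finset.sum_mul, Matrix.trace_sum]
  refine Finset.sum_congr rfl fun j _ => Finset.sum_congr rfl fun j' _ => ?_
  have h₁ : (Q j * Eᴴ * Q j') = Q j * (X j j')ᴴ * Q j' := by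
    have := congrArg Matrix.conjTranspose (hblock j j')
    simpa only [Matrix.conjTranspose_mul, hQ.herm, Matrix.mul_assoc] using this
  calc (Q j' * X j j' * Q j * Eᴴ).trace = (X j j' * (Q j * Eᴴ * Q j')).trace := by
        rw [Matrix.mul_assoc, Matrix.mul_assoc, Matrix.trace_mul_comm]
        simp only [Matrix.mul_assoc]
    _ = (Q j' * X j j' * Q j * (X j j')ᴴ).trace := by
        rw [h₁, Matrix.mul_assoc (Q j'), Matrix.mul_assoc (Q j'), Matrix.trace_mul_comm (Q j')]
        simp only [Matrix.mul_assoc]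
    _ = _ := by
        simp only [hX, conjBy, Matrix.conjTranspose_mul, Matrix.conjTranspose_conjTranspose,
          Matrix.mul_assoc, ← hv]
        conv_rhs => rw [Matrix.trace_mul_comm]
        simp only [Matrix.mul_assoc]

lemma continuous_orderedProd {K R : Type*} [TopologicalSpace K] [TopologicalSpace R] [Monoid R]
    [ContinuousMul R] : ∀ {L : ℕ} {A : K → Fin L → R} (_ : ∀ l, Continuous fun z => A z l),
      Continuous fun z => orderedProd L (A z)
  | 0, _, _ => continuous_const
  | _ + 1, _, hA => (hA _).mul (continuous_orderedProd fun l => hA l.castSucc)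

lemma continuous_freqOp (lam : Fin L → Fin d → ℝ) (P : Fin L → Fin d → Matrix (Fin d) (Fin d) ℂ)
    (ρ : Matrix (Fin d) (Fin d) ℂ) (ω : ℝ) : Continuous (freqOp lam P ρ ω) := by
  have h : ∀ J, Continuous fun V : Fin L → U d => pathProd P V J := fun J =>
    continuous_orderedProd fun l =>
      continuous_const.mul (continuous_subtype_val.comp (continuous_apply l))
  refine continuous_finsetSum _ fun p _ => ?_
  split_ifs
  · exact ((h _).mul continuous_const).mul (h _).matrix_conjTranspose
  · exact continuous_const

end FreqOp

/-! ### Averaging over one layer independent of the rest. -/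

section Moments

variable {d L : ℕ} {Θ K : Type*} [MeasurableSpace Θ] [TopologicalSpace K] [CompactSpace K]
  [MeasurableSpace K] [OpensMeasurableSpace K]

/-- Independence splits each expectation into a twirl entry times the mean of `G`, and only the
identity and swap index patterns survive. Compactness of `K` makes every continuous integrand
integrable. -/
lemma IsTwoDesign.integral_sum_conjBy {μ : Measure Θ} [IsProbabilityMeasure μ] {W : Θ → U d}
    (hd : 2 ≤ d) (hW : Measurable W) (h : IsTwoDesign μ W) {Z : Θ → K} (hZ : Measurable Z)
    (hind : IndepFun W Z μ) (A B : Matrix (Fin d) (Fin d) ℂ) :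
    ∃ a b : ℂ, (a * d ^ 2 + b * d = A.trace * B.trace ∧ a * d + b * d ^ 2 = (A * B).trace) ∧
      ∀ G : Fin d → Fin d → Fin d → Fin d → K → ℂ, (∀ i j k l, Continuous (G i j k l)) →
        ∫ θ, ∑ i, ∑ j, ∑ k, ∑ l, conjBy A (W θ) i j * conjBy B (W θ) k l * G i j k l (Z θ) ∂μ =
          a * ∫ θ, ∑ i, ∑ k, G i i k k (Z θ) ∂μ + b * ∫ θ, ∑ i, ∑ k, G i k k i (Z θ) ∂μ := by
  obtain ⟨a, b, hab, h₁, h₂⟩ := h.exists_twirl hd hW A B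
  refine ⟨a, b, ⟨h₁, h₂⟩, fun G hG => ?_⟩
  have hcW : ∀ i j k l, Continuous fun V : U d => conjBy A V i j * conjBy B V k l :=
    fun i j k l => ((continuous_conjBy A).matrix_elem i j).mul
      ((continuous_conjBy B).matrix_elem k l)
  have hGi : ∀ i j k l, Integrable (fun θ => G i j k l (Z θ)) μ :=
    fun i j k l => integrable_continuous_comp hZ (hG i j k l)
  have hprod : ∀ i j k l, ∫ θ, conjBy A (W θ) i j * conjBy B (W θ) k l * G i j k l (Z θ) ∂μ =
      twirl μ W A B i j k l * ∫ θ, G i j k l (Z θ) ∂μ := fun i j k l =>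
    hind.integral_fun_comp_mul_comp (f := fun V : U d => conjBy A V i j * conjBy B V k l)
      hW.aemeasurable hZ.aemeasurable (hcW i j k l).measurable.aestronglyMeasurable
      (hG i j k l).measurable.aestronglyMeasurable
  have hint : ∀ i j k l, Integrable (fun θ =>
      conjBy A (W θ) i j * conjBy B (W θ) k l * G i j k l (Z θ)) μ := by
    intro i j k l
    have hWi : Integrable (fun θ => conjBy A (W θ) i j * conjBy B (W θ) k l) μ :=
      integrable_conjBy_mul hW A B i j k l
    exact (hind.comp (hcW i j k l).measurable (hG i j k l).measurable).integrable_mul hWi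
      (hGi i j k l)
  have hlhs : ∫ θ, ∑ i, ∑ j, ∑ k, ∑ l,
      conjBy A (W θ) i j * conjBy B (W θ) k l * G i j k l (Z θ) ∂μ =
      ∑ i, ∑ j, ∑ k, ∑ l, twirl μ W A B i j k l * ∫ θ, G i j k l (Z θ) ∂μ := by
    rw [integral_finsetSum _ fun p _ => integrable_finsetSum _ fun q _ =>
      integrable_finsetSum _ fun r _ => integrable_finsetSum _ fun s _ => hint p q r s]
    refine Finset.sum_congr rfl fun p _ => ?_
    rw [integral_finsetSum _ fun q _ =>
      integrable_finsetSum _ fun r _ => integrable_finsetSum _ fun s _ => hint p q r s]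
    refine Finset.sum_congr rfl fun q _ => ?_
    rw [integral_finsetSum _ fun r _ => integrable_finsetSum _ fun s _ => hint p q r s]
    refine Finset.sum_congr rfl fun r _ => ?_
    rw [integral_finsetSum _ fun s _ => hint p q r s]
    exact Finset.sum_congr rfl fun s _ => hprod p q r s
  have hdiag : ∫ θ, ∑ i, ∑ k, G i i k k (Z θ) ∂μ = ∑ i, ∑ k, ∫ θ, G i i k k (Z θ) ∂μ := by
    rw [integral_finsetSum _ fun p _ => integrable_finsetSum _ fun q _ => hGi p p q q]
    exact Finset.sum_congr rfl fun p _ => integral_finsetSum _ fun q _ => hGi p p q q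
  have hswap : ∫ θ, ∑ i, ∑ k, G i k k i (Z θ) ∂μ = ∑ i, ∑ k, ∫ θ, G i k k i (Z θ) ∂μ := by
    rw [integral_finsetSum _ fun p _ => integrable_finsetSum _ fun q _ => hGi p q q p]
    exact Finset.sum_congr rfl fun p _ => integral_finsetSum _ fun q _ => hGi p q q p
  rw [hlhs, hdiag, hswap, Finset.mul_sum, Finset.mul_sum, ← Finset.sum_add_distrib]
  refine Finset.sum_congr rfl fun i _ => ?_
  simp only [hab, add_mul, Finset.sum_add_distrib, Finset.mul_sum]
  congr 1
  · rw [Finset.sum_eq_single i]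
    · refine Finset.sum_congr rfl fun k _ => ?_
      rw [Finset.sum_eq_single k] <;> simp +contextual [eq_comm]
    · intro j _ hj
      simp [hj.symm]
    · simp
  · refine Finset.sum_congr rfl fun j _ => ?_
    rw [Finset.sum_eq_single j]
    · rw [Finset.sum_eq_single i] <;> simp +contextual [eq_comm]
    · intro k _ hk
      simp [hk.symm]
    · simp

/-- The second moment of the block of a random matrix cut out by two projections. -/
lemma IsTwoDesign.integral_trace_conjBy_mul {μ : Measure Θ} [IsProbabilityMeasure μ] {W : Θ → U d}
    (hd : 2 ≤ d) (hW : Measurable W) (h : IsTwoDesign μ W) {Z : Θ → K} (hZ : Measurable Z)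
    (hind : IndepFun W Z μ) (A B : Matrix (Fin d) (Fin d) ℂ)
    {D : K → Matrix (Fin d) (Fin d) ℂ} (hD : Continuous D) :
    ∃ a b : ℂ, (a * d ^ 2 + b * d = A.trace * B.trace ∧ a * d + b * d ^ 2 = (A * B).trace) ∧
      ∫ θ, (conjBy A (W θ) * D (Z θ) * conjBy B (W θ) * (D (Z θ))ᴴ).trace ∂μ =
        a * ((∫ θ, frobSq (D (Z θ)) ∂μ : ℝ) : ℂ) +
          b * ∫ θ, (D (Z θ)).trace * star (D (Z θ)).trace ∂μ := by
  obtain ⟨a, b, hab, hG⟩ := h.integral_sum_conjBy hd hW hZ hind A B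
  refine ⟨a, b, hab, ?_⟩
  have := hG (fun i j k l z => D z j k * star (D z i l)) fun i j k l =>
    (hD.matrix_elem j k).mul (hD.matrix_elem i l).star
  convert this using 1
  · congr 1
    funext θ
    simp only [Matrix.trace, Matrix.diag_apply, Matrix.mul_apply, Matrix.conjTranspose_apply,
      Finset.sum_mul]
    refine Finset.sum_congr rfl fun i _ => ?_
    rw [Finset.sum_comm, Finset.sum_congr rfl fun _ _ => Finset.sum_comm, Finset.sum_comm]
    refine Finset.sum_congr rfl fun q _ => Finset.sum_congr rfl fun r _ =>
      Finset.sum_congr rfl fun s _ => ?_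
    ring
  · rw [← integral_complex_ofReal]
    congr 3
    · funext θ
      simp only [ofReal_frobSq, Matrix.trace, Matrix.diag_apply, Matrix.mul_apply,
        Matrix.conjTranspose_apply]
    · funext θ
      simp only [Matrix.trace, Matrix.diag_apply, star_sum, Finset.sum_mul_sum]
      exact Finset.sum_comm

/-- The second moment of the expectation value of a Hermitian observable. -/
lemma IsTwoDesign.integral_norm_sq_trace {μ : Measure Θ} [IsProbabilityMeasure μ] {W : Θ → U d}
    (hd : 2 ≤ d) (hW : Measurable W) (h : IsTwoDesign μ W) {Z : Θ → K} (hZ : Measurable Z)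
    (hind : IndepFun W Z μ) {A : Matrix (Fin d) (Fin d) ℂ} (hA : Aᴴ = A)
    {D : K → Matrix (Fin d) (Fin d) ℂ} (hD : Continuous D) :
    ∃ a b : ℂ, (a * d ^ 2 + b * d = A.trace * A.trace ∧ a * d + b * d ^ 2 = (A * A).trace) ∧
      ((∫ θ, ‖(conjBy A (W θ) * D (Z θ)).trace‖ ^ 2 ∂μ : ℝ) : ℂ) =
        a * ∫ θ, (D (Z θ)).trace * star (D (Z θ)).trace ∂μ +
          b * ((∫ θ, frobSq (D (Z θ)) ∂μ : ℝ) : ℂ) := by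
  obtain ⟨a, b, hab, hG⟩ := h.integral_sum_conjBy hd hW hZ hind A A
  refine ⟨a, b, hab, ?_⟩
  have := hG (fun i j k l z => D z j i * star (D z k l)) fun i j k l =>
    (hD.matrix_elem j i).mul (hD.matrix_elem k l).star
  rw [← integral_complex_ofReal, ← integral_complex_ofReal]
  convert this using 1
  · congr 1
    funext θ
    have hc : (conjBy A (W θ))ᴴ = conjBy A (W θ) := by
      simp only [conjBy, Matrix.conjTranspose_mul, Matrix.conjTranspose_conjTranspose, hA,
        Matrix.mul_assoc]
    have hs : star (conjBy A (W θ) * D (Z θ)).trace =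
        ∑ k, ∑ l, conjBy A (W θ) k l * star (D (Z θ) k l) := by
      rw [← Matrix.trace_conjTranspose, Matrix.conjTranspose_mul, hc, Matrix.trace_mul_comm]
      simp only [Matrix.trace, Matrix.diag_apply, Matrix.mul_apply, Matrix.conjTranspose_apply]
    rw [Complex.ofReal_pow, ← Complex.mul_conj', ← Complex.star_def, hs]
    simp only [Matrix.trace, Matrix.diag_apply, Matrix.mul_apply, Finset.sum_mul]
    simp only [Finset.mul_sum]
    refine Finset.sum_congr rfl fun p _ => Finset.sum_congr rfl fun q _ =>
      Finset.sum_congr rfl fun r _ => Finset.sum_congr rfl fun s _ => ?_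
    ring
  · congr 3
    · funext θ
      simp only [Matrix.trace, Matrix.diag_apply, star_sum, Finset.sum_mul_sum]
    · funext θ
      simp only [ofReal_frobSq, Matrix.trace, Matrix.diag_apply, Matrix.mul_apply,
        Matrix.conjTranspose_apply]
      exact Finset.sum_comm

end Moments

/-! ### The layer recursion for the second moments and its two bounds. -/

section Recursion

variable {d L : ℕ} {Θ : Type*} [MeasurableSpace Θ]

lemma indepFun_last_init {β : Type*} [MeasurableSpace β] {μ : Measure Θ}
    {W : Fin (L + 1) → Θ → β} (hW : ∀ l, Measurable (W l)) (hind : iIndepFun W μ) :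
    IndepFun (W (Fin.last L)) (fun θ (l : Fin L) => W l.castSucc θ) μ := by
  have hdisj : Disjoint ({Fin.last L} : Finset (Fin (L + 1)))
      (Finset.univ.filter fun l => l ≠ Fin.last L) := by
    simp
  have h := hind.indepFun_finset _ _ hdisj hW
  have hφ : Measurable fun f : ({Fin.last L} : Finset (Fin (L + 1))) → β =>
      f ⟨Fin.last L, Finset.mem_singleton_self _⟩ := measurable_pi_apply _
  have hψ : Measurable fun (f : (Finset.univ.filter fun l : Fin (L + 1) => l ≠ Fin.last L) → β)
      (l : Fin L) => f ⟨l.castSucc, by simp [l.castSucc_lt_last.ne]⟩ :=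
    measurable_pi_lambda _ fun _ => measurable_pi_apply _
  exact h.comp hφ hψ

/-- The mean of the squared Schatten 2-norm of the traceless part of the frequency component. -/
noncomputable def excess (μ : Measure Θ) (lam : Fin L → Fin d → ℝ)
    (P : Fin L → Fin d → Matrix (Fin d) (Fin d) ℂ) (ρ : Matrix (Fin d) (Fin d) ℂ)
    (W : Fin L → Θ → U d) (ω : ℝ) : ℝ :=
  ∫ θ, frobSq (freqOp lam P ρ ω fun l => W l θ) ∂μ - if ω = 0 then 1 / (d : ℝ) else 0

lemma integral_trace_mul_star_trace {μ : Measure Θ} [IsProbabilityMeasure μ]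
    {ρ : Matrix (Fin d) (Fin d) ℂ} (hρ : ρ.trace = 1) (lam : Fin L → Fin d → ℝ)
    {P : Fin L → Fin d → Matrix (Fin d) (Fin d) ℂ} (hP : ∀ l, IsRankOneResolution (P l)) (ω : ℝ)
    (V : Θ → Fin L → U d) :
    ∫ θ, (freqOp lam P ρ ω (V θ)).trace * star (freqOp lam P ρ ω (V θ)).trace ∂μ =
      if ω = 0 then 1 else 0 := by
  simp only [trace_freqOp hρ lam P hP]
  split_ifs <;> simp

/-- The weight of the pair `(j, j')` in the recursion for the second moments. -/
noncomputable def pairWeight (d : ℕ) (j j' : Fin d) : ℝ :=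
  if j = j' then 1 / (d * (d + 1)) else 1 / (d ^ 2 - 1)

lemma pairWeight_nonneg (hd : 2 ≤ d) (j j' : Fin d) : 0 ≤ pairWeight d j j' := by
  have hd' : (2 : ℝ) ≤ d := by exact_mod_cast hd
  unfold pairWeight
  split_ifs
  · positivity
  · exact one_div_nonneg.mpr (by nlinarith)

lemma pairWeight_le (hd : 2 ≤ d) (j j' : Fin d) : pairWeight d j j' ≤ 1 / (d ^ 2 - 1) := by
  have hd' : (2 : ℝ) ≤ d := by exact_mod_cast hd
  unfold pairWeight
  split_ifs
  · exact one_div_le_one_div_of_le (by nlinarith) (by nlinarith)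
  · exact le_rfl

lemma sum_pairWeight (hd : 2 ≤ d) : ∑ j, ∑ j', pairWeight d j j' = 1 := by
  have hd' : (2 : ℝ) ≤ d := by exact_mod_cast hd
  have h : ∀ j j' : Fin d, pairWeight d j j' = 1 / ((d : ℝ) ^ 2 - 1) +
      if j = j' then 1 / ((d : ℝ) * (d + 1)) - 1 / ((d : ℝ) ^ 2 - 1) else 0 := by
    intro j j'
    unfold pairWeight
    split_ifs <;> ring
  have h0 : (d : ℝ) ≠ 0 := by positivity
  have h1 : (d : ℝ) + 1 ≠ 0 := by positivity
  have h2 : (d : ℝ) - 1 ≠ 0 := by linarith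
  have h3 : (d : ℝ) ^ 2 - 1 = (d - 1) * (d + 1) := by ring
  simp only [h, Finset.sum_add_distrib, Finset.sum_ite_eq, Finset.mem_univ, if_true,
    Finset.sum_const, Finset.card_univ, Fintype.card_fin, nsmul_eq_mul, h3]
  field_simp
  ring

/-- Subtracting the squared trace divided by `d` makes the recursion homogeneous: the trace
contributions of the blocks add up to exactly the term subtracted on the left. -/
theorem excess_succ {μ : Measure Θ} [IsProbabilityMeasure μ] (hd : 2 ≤ d)
    {ρ : Matrix (Fin d) (Fin d) ℂ} (hρ : ρ.trace = 1) (lam : Fin (L + 1) → Fin d → ℝ)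
    {P : Fin (L + 1) → Fin d → Matrix (Fin d) (Fin d) ℂ} (hP : ∀ l, IsRankOneResolution (P l))
    {W : Fin (L + 1) → Θ → U d} (hW : ∀ l, Measurable (W l)) (hind : iIndepFun W μ)
    (hdes : IsTwoDesign μ (W (Fin.last L))) (ω : ℝ) :
    excess μ lam P ρ W ω = ∑ j, ∑ j', pairWeight d j j' *
      excess μ (fun l => lam l.castSucc) (fun l => P l.castSucc) ρ (fun l => W l.castSucc)
        (ω - lam (Fin.last L) j + lam (Fin.last L) j') := by
  set D : ℝ → (Fin L → U d) → Matrix (Fin d) (Fin d) ℂ :=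
    freqOp (fun l => lam l.castSucc) (fun l => P l.castSucc) ρ with hD
  set Z : Θ → Fin L → U d := fun θ l => W l.castSucc θ with hZ
  have hZm : Measurable Z := measurable_pi_lambda _ fun l => hW l.castSucc
  have hDc : ∀ ν, Continuous (D ν) := fun ν => continuous_freqOp _ _ _ _
  have hdR : (2 : ℝ) ≤ d := by exact_mod_cast hd
  have h0 : (d : ℂ) ≠ 0 := by
    have : d ≠ 0 := by omega
    exact_mod_cast this
  have h1 : (d : ℂ) + 1 ≠ 0 := by exact_mod_cast d.succ_ne_zero
  have h2 : (d : ℂ) - 1 ≠ 0 := by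
    have : (d : ℝ) - 1 ≠ 0 := by linarith
    exact_mod_cast this
  have h3 : (d : ℂ) ^ 2 - 1 = (d - 1) * (d + 1) := by ring
  set f : Fin d → Fin d → ℝ := fun j j' => ω - lam (Fin.last L) j + lam (Fin.last L) j' with hf
  set e : ℝ → ℝ := excess μ (fun l => lam l.castSucc) (fun l => P l.castSucc) ρ
    (fun l => W l.castSucc) with he
  -- For `j = j'` the twirl has `a = b = 1/(d(d+1))`, leaving a surplus `1/d²` when `ω = 0`; the `d`
  -- diagonal blocks together give `1/d`. For `j ≠ j'` it has `a = 1/(d² - 1)` and `b = -a/d`, so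
  -- the trace term is absorbed with no surplus.
  have hblock : ∀ j j', ∫ θ, (conjBy (P (Fin.last L) j') (W (Fin.last L) θ) * D (f j j') (Z θ) *
      conjBy (P (Fin.last L) j) (W (Fin.last L) θ) * (D (f j j') (Z θ))ᴴ).trace ∂μ =
      ((pairWeight d j j' * e (f j j') +
        if j = j' then (if ω = 0 then 1 / (d : ℝ) ^ 2 else 0) else 0 : ℝ) : ℂ) := by
    intro j j'
    obtain ⟨a, b, ⟨h₁, h₂⟩, hI⟩ := hdes.integral_trace_conjBy_mul hd (hW _) hZm
      (indepFun_last_init hW hind) (P (Fin.last L) j') (P (Fin.last L) j) (hDc (f j j'))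
    rw [hI, hD, integral_trace_mul_star_trace hρ _ (fun l => hP l.castSucc)]
    rw [(hP _).trace_eq_one, (hP _).trace_eq_one] at h₁
    simp only [he, excess, pairWeight]
    by_cases hj : j = j'
    · subst hj
      rw [(hP _).mul_self, (hP _).trace_eq_one] at h₂
      have hab : a = b := by
        have : (a - b) * (d * (d - 1)) = 0 := by linear_combination h₁ - h₂
        exact sub_eq_zero.mp ((mul_eq_zero.mp this).resolve_right (mul_ne_zero h0 h2))
      subst hab
      have ha : a = 1 / (d * (d + 1)) := by
        field_simp
        linear_combination h₁
      have hω : f j j = ω := by simp [hf]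
      simp only [hω, if_true, ha]
      split_ifs <;> push_cast <;> field_simp <;> ring
    · rw [(hP _).mul_of_ne _ _ (Ne.symm hj), Matrix.trace_zero] at h₂
      have ha : a = -b * d := by
        have : (a + b * d) * d = 0 := by linear_combination h₂
        linear_combination (mul_eq_zero.mp this).resolve_right h0
      have hb : b = -(1 / (d * ((d - 1) * (d + 1)))) := by
        rw [ha] at h₁
        field_simp
        linear_combination -h₁
      simp only [hj, if_false, ha, hb]
      push_cast
      rw [h3]
      split_ifs <;> push_cast <;> field_simp <;> ring
  have hmain : ((∫ θ, frobSq (freqOp lam P ρ ω fun l => W l θ) ∂μ : ℝ) : ℂ) =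
      ∑ j, ∑ j', ((pairWeight d j j' * e (f j j') +
        if j = j' then (if ω = 0 then 1 / (d : ℝ) ^ 2 else 0) else 0 : ℝ) : ℂ) := by
    rw [← integral_complex_ofReal]
    simp only [frobSq_freqOp_succ lam P hP ρ ω _ _ rfl]
    have hint : ∀ j j', Integrable (fun θ => (conjBy (P (Fin.last L) j') (W (Fin.last L) θ) *
        D (f j j') (Z θ) * conjBy (P (Fin.last L) j) (W (Fin.last L) θ) *
        (D (f j j') (Z θ))ᴴ).trace) μ := by
      intro j j'
      refine integrable_continuous_comp (Z := fun θ => (W (Fin.last L) θ, Z θ))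
        (g := fun z => (conjBy (P (Fin.last L) j') z.1 * D (f j j') z.2 *
          conjBy (P (Fin.last L) j) z.1 * (D (f j j') z.2)ᴴ).trace) ((hW _).prodMk hZm) ?_
      have hD2 : Continuous fun z : U d × (Fin L → U d) => D (f j j') z.2 :=
        (hDc _).comp continuous_snd
      have hc : ∀ A, Continuous fun z : U d × (Fin L → U d) => conjBy A z.1 :=
        fun A => (continuous_conjBy A).comp continuous_fst
      exact ((((hc _).mul hD2).mul (hc _)).mul hD2.matrix_conjTranspose).matrix_trace
    rw [integral_finsetSum _ fun j _ => integrable_finsetSum _ fun j' _ => hint j j']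
    refine Finset.sum_congr rfl fun j _ => ?_
    rw [integral_finsetSum _ fun j' _ => hint j j']
    exact Finset.sum_congr rfl fun j' _ => hblock j j'
  have hmain' : ∫ θ, frobSq (freqOp lam P ρ ω fun l => W l θ) ∂μ =
      ∑ j, ∑ j', (pairWeight d j j' * e (f j j') +
        if j = j' then (if ω = 0 then 1 / (d : ℝ) ^ 2 else 0) else 0) := by
    exact_mod_cast hmain
  rw [excess, hmain']
  have hd0 : (d : ℝ) ≠ 0 := by positivity
  simp only [Finset.sum_add_distrib, Finset.sum_ite_eq, Finset.mem_univ, if_true,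
    Finset.sum_const, Finset.card_univ, Fintype.card_fin, nsmul_eq_mul]
  split_ifs
  · field_simp
    ring
  · simp [hf]

/-- The bound 1 survives each step because the weights average. The counting bound survives because
each weight is at most `1/(d² - 1)` and `freqCount` obeys the same recursion with unit weights. -/
theorem excess_le {μ : Measure Θ} [IsProbabilityMeasure μ] (hd : 2 ≤ d)
    {ρ : Matrix (Fin d) (Fin d) ℂ} (hρ : ρ.trace = 1) (hρ' : frobSq ρ ≤ 1) :
    ∀ {L : ℕ} (lam : Fin L → Fin d → ℝ) {P : Fin L → Fin d → Matrix (Fin d) (Fin d) ℂ}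
      (_ : ∀ l, IsRankOneResolution (P l)) {W : Fin L → Θ → U d} (_ : ∀ l, Measurable (W l))
      (_ : iIndepFun W μ) (_ : ∀ l, IsTwoDesign μ (W l)) (ω : ℝ),
      excess μ lam P ρ W ω ≤ 1 ∧
        excess μ lam P ρ W ω ≤ freqCount lam ω / ((d : ℝ) ^ 2 - 1) ^ L
  | 0, lam, P, _, W, _, _, _, ω => by
    have hd' : (0 : ℝ) ≤ (d : ℝ)⁻¹ := by positivity
    have hz : frobSq (0 : Matrix (Fin d) (Fin d) ℂ) = 0 := by simp [frobSq]
    simp only [excess, freqOp_zero, freqCount_zero]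
    split_ifs
    · simp only [integral_const, probReal_univ, one_smul, pow_zero, div_one, and_self]
      rw [one_div]
      linarith
    · simp [hz]
  | L + 1, lam, P, hP, W, hW, hind, hdes, ω => by
    have hdR : (2 : ℝ) ≤ d := by exact_mod_cast hd
    have hpos : (0 : ℝ) < (d : ℝ) ^ 2 - 1 := by nlinarith
    have ih := fun ν => excess_le hd hρ hρ' (fun l => lam l.castSucc) (fun l => hP l.castSucc)
      (fun l => hW l.castSucc) (hind.precomp (Fin.castSucc_injective L))
      (fun l => hdes l.castSucc) ν
    rw [excess_succ hd hρ lam hP hW hind (hdes _)]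
    constructor
    · rw [← sum_pairWeight hd]
      refine Finset.sum_le_sum fun j _ => Finset.sum_le_sum fun j' _ => ?_
      exact mul_le_of_le_one_right (pairWeight_nonneg hd j j') (ih _).1
    · rw [freqCount_succ, Finset.sum_div]
      refine Finset.sum_le_sum fun j _ => ?_
      rw [Finset.sum_div]
      refine Finset.sum_le_sum fun j' _ => ?_
      refine (mul_le_mul_of_nonneg_left (ih _).2 (pairWeight_nonneg hd j j')).trans ?_
      refine (mul_le_mul_of_nonneg_right (pairWeight_le hd j j')
        (div_nonneg (freqCount_nonneg _ _) (pow_nonneg hpos.le _))).trans_eq ?_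
      rw [pow_succ]
      field_simp
      ring

end Recursion

/-! ### Centering, and the average over the last trainable layer. -/

section Variance

variable {d L : ℕ} {Θ : Type*} [MeasurableSpace Θ]

/-- The mean minimizes the mean square distance: expanding around it, the cross term integrates to
zero. This allows centering at a convenient constant without computing the mean. -/
lemma complexVariance_le {μ : Measure Θ} [IsProbabilityMeasure μ] {X : Θ → ℂ}
    (hX : Integrable X μ) (hX' : ∀ c : ℂ, Integrable (fun θ => ‖X θ - c‖ ^ 2) μ) (c : ℂ) :
    complexVariance μ X ≤ ∫ θ, ‖X θ - c‖ ^ 2 ∂μ := by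
  set m := ∫ θ, X θ ∂μ with hm
  have hXm : Integrable (fun θ => (X θ - m) * star (m - c)) μ :=
    (hX.sub (integrable_const m)).mul_const _
  have h0 : ∫ θ, ((X θ - m) * star (m - c)).re ∂μ = 0 := by
    have := integral_re hXm
    simp only [RCLike.re_eq_complex_re] at this
    rw [this, integral_mul_const, integral_sub hX (integrable_const m)]
    simp [hm]
  have hpt : ∀ θ, ‖X θ - c‖ ^ 2 =
      ‖X θ - m‖ ^ 2 + (2 * ((X θ - m) * star (m - c)).re + ‖m - c‖ ^ 2) := by
    intro θ
    simp only [← Complex.normSq_eq_norm_sq, Complex.normSq_apply, Complex.star_def,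
      Complex.mul_re, Complex.conj_re, Complex.conj_im, Complex.sub_re, Complex.sub_im]
    ring
  have hre : Integrable (fun θ => 2 * ((X θ - m) * star (m - c)).re) μ := hXm.re.const_mul 2
  have hre' : Integrable (fun θ => 2 * ((X θ - m) * star (m - c)).re + ‖m - c‖ ^ 2) μ :=
    hre.add (integrable_const _)
  simp only [hpt]
  rw [integral_add (hX' m) hre', integral_add hre (integrable_const _),
    integral_const_mul, h0]
  simp only [complexVariance, ← hm, integral_const, probReal_univ, one_smul, mul_zero, zero_add]
  exact le_add_of_nonneg_right (sq_nonneg _)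

/-- The traceless part of a matrix. -/
noncomputable def tracelessPart (A : Matrix (Fin d) (Fin d) ℂ) : Matrix (Fin d) (Fin d) ℂ :=
  A - (A.trace / d) • (1 : Matrix (Fin d) (Fin d) ℂ)

lemma trace_tracelessPart (hd : d ≠ 0) (A : Matrix (Fin d) (Fin d) ℂ) :
    (tracelessPart A).trace = 0 := by
  have : (d : ℂ) ≠ 0 := by exact_mod_cast hd
  simp [tracelessPart, this]

lemma trace_re_of_herm {A : Matrix (Fin d) (Fin d) ℂ} (hA : A.IsHermitian) :
    (A.trace.re : ℂ) = A.trace := by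
  have h := Matrix.trace_conjTranspose A
  rw [hA.eq] at h
  exact Complex.conj_eq_iff_re.mp h.symm

lemma conjTranspose_tracelessPart {A : Matrix (Fin d) (Fin d) ℂ} (hA : A.IsHermitian) :
    (tracelessPart A)ᴴ = tracelessPart A := by
  have h : star A.trace = A.trace := by
    rw [← Matrix.trace_conjTranspose, hA.eq]
  simp only [tracelessPart, Matrix.conjTranspose_sub, hA.eq, Matrix.conjTranspose_smul,
    Matrix.conjTranspose_one, star_div₀, h]
  simp

lemma frobSq_tracelessPart (hd : d ≠ 0) {A : Matrix (Fin d) (Fin d) ℂ} (hA : A.IsHermitian) :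
    frobSq (tracelessPart A) = frobSq A - A.trace.re ^ 2 / d := by
  have h0 : (d : ℂ) ≠ 0 := by exact_mod_cast hd
  have : (frobSq (tracelessPart A) : ℂ) = ((frobSq A - A.trace.re ^ 2 / d : ℝ) : ℂ) := by
    push_cast
    rw [ofReal_frobSq, ofReal_frobSq, conjTranspose_tracelessPart hA, trace_re_of_herm hA, hA.eq]
    simp only [tracelessPart, sub_mul, mul_sub, Matrix.smul_mul, Matrix.mul_smul, Matrix.one_mul,
      Matrix.mul_one, Matrix.trace_sub, Matrix.trace_smul, Matrix.trace_one, Fintype.card_fin,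
      smul_eq_mul]
    field_simp
    ring
  exact_mod_cast this

lemma trace_conjBy_mul_eq (A D : Matrix (Fin d) (Fin d) ℂ) (V : U d) :
    (conjBy A V * D).trace = (conjBy (tracelessPart A) V * D).trace + A.trace / d * D.trace := by
  have h : V.1ᴴ * V.1 = 1 := Matrix.mem_unitaryGroup_iff'.mp V.2
  simp only [tracelessPart, conjBy, Matrix.mul_sub, Matrix.sub_mul, Matrix.mul_smul,
    Matrix.smul_mul, Matrix.mul_one, h, Matrix.one_mul, Matrix.trace_sub, Matrix.trace_smul,
    smul_eq_mul]
  ring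

/-- The mean square of the expectation value of a traceless observable. -/
theorem integral_norm_sq_trace_freqOp {μ : Measure Θ} [IsProbabilityMeasure μ] (hd : 2 ≤ d)
    {ρ : Matrix (Fin d) (Fin d) ℂ} (hρ : ρ.trace = 1) (lam : Fin L → Fin d → ℝ)
    {P : Fin L → Fin d → Matrix (Fin d) (Fin d) ℂ} (hP : ∀ l, IsRankOneResolution (P l))
    {W : Fin (L + 1) → Θ → U d} (hW : ∀ l, Measurable (W l)) (hind : iIndepFun W μ)
    (hdes : IsTwoDesign μ (W (Fin.last L))) {A : Matrix (Fin d) (Fin d) ℂ} (hA : Aᴴ = A)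
    (hA0 : A.trace = 0) (ω : ℝ) :
    ∫ θ, ‖(conjBy A (W (Fin.last L) θ) * freqOp lam P ρ ω fun l => W l.castSucc θ).trace‖ ^ 2 ∂μ =
      frobSq A / ((d : ℝ) ^ 2 - 1) * excess μ lam P ρ (fun l => W l.castSucc) ω := by
  have hdR : (2 : ℝ) ≤ d := by exact_mod_cast hd
  have h0 : (d : ℂ) ≠ 0 := by
    have : d ≠ 0 := by omega
    exact_mod_cast this
  have h1 : (d : ℂ) ^ 2 - 1 ≠ 0 := by
    have : (d : ℝ) ^ 2 - 1 ≠ 0 := by nlinarith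
    exact_mod_cast this
  obtain ⟨a, b, ⟨h₁, h₂⟩, hI⟩ := hdes.integral_norm_sq_trace hd (hW _)
    (measurable_pi_lambda _ fun l => hW l.castSucc) (indepFun_last_init hW hind) hA
    (continuous_freqOp lam P ρ ω)
  rw [integral_trace_mul_star_trace hρ lam hP] at hI
  have hF : (frobSq A : ℂ) = (A * A).trace := by rw [ofReal_frobSq, hA]
  rw [← hF] at h₂
  rw [hA0] at h₁
  -- Tracelessness of `A` forces `a = -b/d`, so the trace term becomes precisely the correction
  -- subtracted in `excess`.
  have ha : a * d = -b := by
    have : (a * d + b) * d = 0 := by linear_combination h₁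
    linear_combination (mul_eq_zero.mp this).resolve_right h0
  have hb : b = frobSq A / ((d : ℂ) ^ 2 - 1) := by
    rw [eq_div_iff h1]
    linear_combination h₂ - ha
  have ha' : a = -b / d := by
    rw [eq_div_iff h0, ha]
  rw [← Complex.ofReal_inj, hI, ha', hb, excess]
  push_cast
  split_ifs <;> push_cast <;> field_simp <;> ring

end Variance

/-! ### Variance bounds for the Fourier coefficients of a model. -/

namespace QuantumModel

variable {n L : ℕ} {Θ : Type*}

lemma isRankOneResolution_eigProj (M : QuantumModel n L Θ) (l : Fin L) :
    IsRankOneResolution (M.eigProj l) := by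
  have hdot : ∀ j k, (star fun a => (M.ham_herm l).eigenvectorBasis j a) ⬝ᵥ
      (fun a => (M.ham_herm l).eigenvectorBasis k a) = if j = k then 1 else 0 := by
    intro j k
    rw [← orthonormal_iff_ite.mp (M.ham_herm l).eigenvectorBasis.orthonormal j k,
      EuclideanSpace.inner_eq_star_dotProduct, dotProduct_comm]
  refine ⟨fun j => ?_, fun j => ?_, fun j k hjk => ?_, ?_, fun j => ?_⟩
  · rw [eigProj, Matrix.conjTranspose_vecMulVec, star_star]
  · rw [eigProj, Matrix.vecMulVec_mul_vecMulVec, hdot]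
    simp
  · rw [eigProj, eigProj, Matrix.vecMulVec_mul_vecMulVec, hdot]
    simp [hjk]
  · have h := Matrix.mem_unitaryGroup_iff.mp (M.ham_herm l).eigenvectorUnitary.2
    rw [← h]
    ext a b
    simp only [Matrix.sum_apply, Matrix.mul_apply, eigProj, Matrix.vecMulVec_apply, Pi.star_apply,
      Matrix.star_apply, Matrix.IsHermitian.eigenvectorUnitary_apply]
  · rw [eigProj, Matrix.trace_vecMulVec, dotProduct_comm, hdot]
    simp

lemma normalizedRedundancy_eq (M : QuantumModel n L Θ) (ω : ℝ) :
    M.normalizedRedundancy ω = freqCount M.eig ω / ((2 : ℝ) ^ n) ^ (2 * L) := by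
  rw [normalizedRedundancy, freqCount, generator, Finset.sum_boole]
  congr!

lemma alpha_eq (M : QuantumModel n L Θ) :
    M.alpha = frobSq (tracelessPart M.obs) / (2 : ℝ) ^ n := by
  rw [frobSq_tracelessPart (by positivity) M.obs_herm, alpha]
  have : M.obsNormSq = frobSq M.obs := rfl
  rw [this]
  push_cast
  field_simp

/-- Cyclicity of the trace moves the earlier layers from around the observable onto the initial
state `|0⟩⟨0|`. -/
lemma coeff_eq_trace (M : QuantumModel n L Θ) (ω : ℝ) (θ : Θ) :
    M.coeff ω θ = (conjBy M.obs (M.W (Fin.last L) θ) *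
      freqOp M.eig M.eigProj (Matrix.single 0 0 1) ω fun l => M.W l.castSucc θ).trace := by
  classical
  have h00 : ∀ A : Matrix (Fin (2 ^ n)) (Fin (2 ^ n)) ℂ,
      A 0 0 = (A * Matrix.single 0 0 1).trace := by
    intro A
    simp [Matrix.trace_mul_single]
  rw [coeff, generator, Finset.sum_filter, freqOp, Finset.mul_sum, Matrix.trace_sum]
  refine Finset.sum_congr rfl fun p _ => ?_
  have hf : M.freq p = pathFreq M.eig p := rfl
  rw [hf]
  split_ifs with h
  · have hp : ∀ J, M.pathOp J θ = (M.W (Fin.last L) θ : Matrix _ _ ℂ) *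
        pathProd M.eigProj (fun l => M.W l.castSucc θ) J := fun J => rfl
    rw [h00 ((M.pathOp p.1 θ)ᴴ * M.obs * M.pathOp p.2 θ), hp, hp, conjBy, Matrix.conjTranspose_mul]
    simp only [Matrix.mul_assoc]
    rw [Matrix.trace_mul_comm]
    simp only [Matrix.mul_assoc]
  · simp

variable [MeasurableSpace Θ]

lemma complexVariance_coeff_le_integral {μ : Measure Θ} [IsProbabilityMeasure μ]
    (M : QuantumModel n L Θ) (hM : M.HasTwoDesignLayers μ) (ω : ℝ) :
    complexVariance μ (M.coeff ω) ≤ ∫ θ, ‖(conjBy (tracelessPart M.obs) (M.W (Fin.last L) θ) *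
      freqOp M.eig M.eigProj (Matrix.single 0 0 1) ω fun l => M.W l.castSucc θ).trace‖ ^ 2 ∂μ := by
  -- The contribution of the scalar part of the observable, constant in `θ` because the trace of
  -- `freqOp` is.
  set c : ℂ := M.obs.trace / (2 ^ n : ℕ) * if ω = 0 then 1 else 0 with hc
  have hsub : ∀ θ, (conjBy (tracelessPart M.obs) (M.W (Fin.last L) θ) *
      freqOp M.eig M.eigProj (Matrix.single 0 0 1) ω fun l => M.W l.castSucc θ).trace =
      M.coeff ω θ - c := by
    intro θ
    rw [coeff_eq_trace, trace_conjBy_mul_eq M.obs, trace_freqOp (by simp) _ _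
      M.isRankOneResolution_eigProj, hc]
    ring
  simp only [hsub]
  have hcont : Continuous fun V : Fin (L + 1) → U (2 ^ n) => (conjBy M.obs (V (Fin.last L)) *
      freqOp M.eig M.eigProj (Matrix.single 0 0 1) ω fun l => V l.castSucc).trace :=
    (((continuous_conjBy M.obs).comp (continuous_apply (Fin.last L))).mul
      ((continuous_freqOp M.eig M.eigProj (Matrix.single 0 0 1) ω).comp
        (continuous_pi fun l : Fin L => continuous_apply l.castSucc))).matrix_trace
  have hmeas : Measurable fun θ l => M.W l θ := measurable_pi_lambda _ hM.measurable
  refine complexVariance_le ?_ (fun m => ?_) c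
  · simp only [funext (M.coeff_eq_trace ω)]
    exact integrable_continuous_comp hmeas hcont
  · simp only [coeff_eq_trace]
    have := integrable_continuous_comp (μ := μ) hmeas
      (Complex.continuous_ofReal.comp ((hcont.sub continuous_const).norm.pow 2) :
        Continuous fun V : Fin (L + 1) → U (2 ^ n) => ((‖(conjBy M.obs (V (Fin.last L)) *
      freqOp M.eig M.eigProj (Matrix.single 0 0 1) ω fun l => V l.castSucc).trace - m‖ ^ 2 : ℝ) : ℂ))
    exact this.re.congr (ae_of_all _ fun θ => Complex.ofReal_re _)

lemma complexVariance_coeff_le {μ : Measure Θ} [IsProbabilityMeasure μ] (hn : n ≠ 0)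
    (M : QuantumModel n L Θ) (hM : M.HasTwoDesignLayers μ) (ω : ℝ) :
    complexVariance μ (M.coeff ω) ≤
        frobSq (tracelessPart M.obs) / (((2 : ℝ) ^ n) ^ 2 - 1) ∧
      complexVariance μ (M.coeff ω) ≤ frobSq (tracelessPart M.obs) / (((2 : ℝ) ^ n) ^ 2 - 1) *
        (freqCount M.eig ω / (((2 : ℝ) ^ n) ^ 2 - 1) ^ L) := by
  have hd : 2 ≤ 2 ^ n := Nat.le_self_pow hn 2
  have hdR : (2 : ℝ) ≤ 2 ^ n := by exact_mod_cast hd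
  have hpos : (0 : ℝ) ≤ frobSq (tracelessPart M.obs) / (((2 : ℝ) ^ n) ^ 2 - 1) :=
    div_nonneg (frobSq_nonneg _) (by nlinarith)
  have hρ : (Matrix.single 0 0 1 : Matrix (Fin (2 ^ n)) (Fin (2 ^ n)) ℂ).trace = 1 := by simp
  have hρ' : frobSq (Matrix.single 0 0 1 : Matrix (Fin (2 ^ n)) (Fin (2 ^ n)) ℂ) ≤ 1 := by
    have : (frobSq (Matrix.single 0 0 1 : Matrix (Fin (2 ^ n)) (Fin (2 ^ n)) ℂ) : ℂ) = 1 := by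
      rw [ofReal_frobSq]
      simp
    exact le_of_eq (by exact_mod_cast this)
  have hle := M.complexVariance_coeff_le_integral hM ω
  rw [integral_norm_sq_trace_freqOp hd hρ _ M.isRankOneResolution_eigProj hM.measurable hM.indep
    (hM.design _) (conjTranspose_tracelessPart M.obs_herm)
    (trace_tracelessPart (by positivity) _)] at hle
  obtain ⟨h₁, h₂⟩ := excess_le hd hρ hρ' M.eig M.isRankOneResolution_eigProj
    (fun l => hM.measurable l.castSucc) (hM.indep.precomp (Fin.castSucc_injective L))
    (fun l => hM.design l.castSucc) ω
  push_cast at hle h₂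
  exact ⟨hle.trans (mul_le_of_le_one_right hpos h₁),
    hle.trans (mul_le_mul_of_nonneg_left h₂ hpos)⟩

/-- For `d = 1` every observable is scalar, so its traceless part is zero. The case is separate
because `d² - 1` vanishes and the twirl formula needs `d ≥ 2`. -/
lemma complexVariance_coeff_le_zero {μ : Measure Θ} [IsProbabilityMeasure μ]
    (M : QuantumModel 0 L Θ) (hM : M.HasTwoDesignLayers μ) (ω : ℝ) :
    complexVariance μ (M.coeff ω) ≤ 0 := by
  have h : tracelessPart M.obs = 0 := by
    ext i j
    have : Subsingleton (Fin (2 ^ 0)) := by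
      rw [pow_zero]
      infer_instance
    obtain rfl := Subsingleton.elim i 0
    obtain rfl := Subsingleton.elim j 0
    simp [tracelessPart, Matrix.trace]
  have := M.complexVariance_coeff_le_integral hM ω
  simpa [h, conjBy] using this

end QuantumModel

/-! ### Uniformity in the number of layers, and the conclusion. -/

/-- Used with `q = d² - 1`. Here `(1 + 1/q)^(L+1) ≤ exp((L+1)/q)`, and `q ≥ 3` gives `(q+1)/q ≤ 4/3`
and `1/q ≤ 1/3`, whence the exponent `(4κ+1)/3`. -/
lemma div_pow_le_exp {κ q : ℝ} (hκ : 0 ≤ κ) (hq : 3 ≤ q) {L : ℕ} (hL : (L : ℝ) ≤ κ * (q + 1)) :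
    1 / q ^ (L + 1) ≤ Real.exp ((4 * κ + 1) / 3) / (q + 1) ^ (L + 1) := by
  have hq0 : 0 < q := by linarith
  have h₁ : (q + 1) / q ≤ Real.exp (1 / q) := by
    have := Real.add_one_le_exp (1 / q)
    rw [add_div, div_self hq0.ne']
    linarith
  have h₂ : ((q + 1) / q) ^ (L + 1) ≤ Real.exp ((4 * κ + 1) / 3) := by
    refine (pow_le_pow_left₀ (by positivity) h₁ _).trans ?_
    rw [← Real.exp_nat_mul, Real.exp_le_exp, mul_one_div, div_le_div_iff₀ hq0 (by norm_num)]
    push_cast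
    nlinarith
  rw [div_pow] at h₂
  rw [le_div_iff₀ (by positivity)]
  calc 1 / q ^ (L + 1) * (q + 1) ^ (L + 1) = (q + 1) ^ (L + 1) / q ^ (L + 1) := by ring
    _ ≤ _ := h₂

end QFM

theorem corollary1 :
    (∀ κ : ℝ, ∃ C : ℝ, ∀ (n L : ℕ), 1 ≤ L → (L : ℝ) ≤ κ * ((2 : ℝ) ^ n) ^ 2 →
      ∀ (Θ : Type*) [MeasurableSpace Θ] (μ : Measure Θ) [IsProbabilityMeasure μ]
        (M : QFM.QuantumModel n L Θ), M.HasTwoDesignLayers μ → ∀ ω ∈ M.spectrum,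
          QFM.complexVariance μ (M.coeff ω) ≤
            C * (M.alpha * M.normalizedRedundancy ω / (2 : ℝ) ^ n)) ∧
    (∃ b : ℝ, 1 < b ∧ ∀ K : ℝ, ∃ C : ℝ, ∀ (n L : ℕ), 1 ≤ L →
      ∀ (Θ : Type*) [MeasurableSpace Θ] (μ : Measure Θ) [IsProbabilityMeasure μ]
        (M : QFM.QuantumModel n L Θ), M.HasTwoDesignLayers μ →
        M.obsNormSq ≤ K * (2 : ℝ) ^ n → ∀ ω ∈ M.spectrum,
          QFM.complexVariance μ (M.coeff ω) ≤ C * (1 / b ^ n)) := by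
  have hbase : ∀ n : ℕ, n ≠ 0 → (2 : ℝ) ≤ 2 ^ n := fun n hn => by
    exact_mod_cast Nat.le_self_pow hn 2
  -- The factor `4/3` is the largest value of `d²/(d² - 1)` for `d ≥ 2`, attained at `d = 2`; the
  -- absolute value keeps the constant nonnegative for every `K`.
  refine ⟨fun κ => ⟨Real.exp ((4 * κ + 1) / 3), ?_⟩, 2, one_lt_two, fun K => ⟨4 / 3 * |K|, ?_⟩⟩
  · intro n L hL hLκ Θ _ μ _ M hM ω _
    have hs := QFM.frobSq_nonneg (QFM.tracelessPart M.obs)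
    have hN := QFM.freqCount_nonneg M.eig ω
    -- The powers of `d` come from `α` (one), the redundancy (`2L`) and the explicit denominator
    -- (one), together `(d²)^(L+1)`; `d²` is written `(d² - 1) + 1` to match `div_pow_le_exp`.
    have hrhs : Real.exp ((4 * κ + 1) / 3) *
        (M.alpha * M.normalizedRedundancy ω / (2 : ℝ) ^ n) =
        QFM.frobSq (QFM.tracelessPart M.obs) * QFM.freqCount M.eig ω *
          (Real.exp ((4 * κ + 1) / 3) / ((((2 : ℝ) ^ n) ^ 2 - 1) + 1) ^ (L + 1)) := by
      rw [M.alpha_eq, M.normalizedRedundancy_eq, sub_add_cancel, ← pow_mul _ 2 (L + 1),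
        mul_add 2 L 1, pow_add]
      field_simp
      ring
    rw [hrhs]
    rcases Nat.eq_zero_or_pos n with rfl | hn
    · exact (M.complexVariance_coeff_le_zero hM ω).trans (by simp; positivity)
    · have hd := hbase n hn.ne'
      have hκ : 0 ≤ κ := by
        have h1 : (1 : ℝ) ≤ L := by exact_mod_cast hL
        by_contra hneg
        nlinarith [sq_nonneg ((2 : ℝ) ^ n)]
      refine (M.complexVariance_coeff_le hn.ne' hM ω).2.trans ?_
      calc QFM.frobSq (QFM.tracelessPart M.obs) / (((2 : ℝ) ^ n) ^ 2 - 1) *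
            (QFM.freqCount M.eig ω / (((2 : ℝ) ^ n) ^ 2 - 1) ^ L) =
            QFM.frobSq (QFM.tracelessPart M.obs) * QFM.freqCount M.eig ω *
              (1 / (((2 : ℝ) ^ n) ^ 2 - 1) ^ (L + 1)) := by
            rw [pow_succ _ L, div_mul_div_comm, mul_one_div, mul_comm (((2 : ℝ) ^ n) ^ 2 - 1)]
        _ ≤ _ := mul_le_mul_of_nonneg_left
            (QFM.div_pow_le_exp hκ (by nlinarith) (by linarith)) (mul_nonneg hs hN)
  · intro n L _ Θ _ μ _ M hM hK ω _
    rcases Nat.eq_zero_or_pos n with rfl | hn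
    · exact (M.complexVariance_coeff_le_zero hM ω).trans (by positivity)
    · have hd := hbase n hn.ne'
      have hq : (0 : ℝ) < ((2 : ℝ) ^ n) ^ 2 - 1 := by nlinarith
      have hs : QFM.frobSq (QFM.tracelessPart M.obs) ≤ |K| * 2 ^ n := by
        rw [QFM.frobSq_tracelessPart (by positivity) M.obs_herm]
        have h1 : QFM.frobSq M.obs ≤ |K| * 2 ^ n :=
          hK.trans (mul_le_mul_of_nonneg_right (le_abs_self K) (by positivity))
        have h2 : 0 ≤ M.obs.trace.re ^ 2 / ((2 ^ n : ℕ) : ℝ) := by positivity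
        linarith
      refine (M.complexVariance_coeff_le hn.ne' hM ω).1.trans ?_
      rw [div_le_iff₀ hq]
      refine hs.trans ?_
      -- Equivalent to `d² ≥ 4`.
      have hkey : (2 : ℝ) ^ n ≤ 4 / 3 * (1 / 2 ^ n) * (((2 : ℝ) ^ n) ^ 2 - 1) := by
        rw [mul_one_div, div_mul_eq_mul_div, le_div_iff₀ (by positivity)]
        nlinarith
      calc |K| * 2 ^ n ≤ |K| * (4 / 3 * (1 / 2 ^ n) * (((2 : ℝ) ^ n) ^ 2 - 1)) :=
            mul_le_mul_of_nonneg_left hkey (abs_nonneg K)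
        _ = _ := by ring
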